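/- Let $(\Omega,\mathcal A,\mathbb P)$ be a probability space with expectation $\mathbb E$, $E$ a real Banach space with closed dual unit ball $B_{E'}$, and $k\in\mathbb N=\{1,2,\dots\}$. Let $\otimes^{k,s}E$ be the linear span, inside the algebraic tensor product of $k$ copies of $E$, of all symmetrizations $\frac1{k!}\sum_{\sigma\in S_k}x_{\sigma(1)}\otimes\cdots\otimes x_{\sigma(k)}$ ($x_1,\dots,x_k\in E$), equipped with the symmetric injective tensor norm $\|U\|_{\varepsilon_s}=\sup_{f\in B_{E'}}|(f\otimes\cdots\otimes f)(U)|$, i.e. $\sup_{f\in B_{E'}}|\sum_j\lambda_jf(x_j)^k|$ if $U=\sum_j\lambda_j\,{\otimes^k}x_j$, where ${\otimes^k}x=x\otimes\cdots\otimes x$; let $\otimes^{k,s}_{\varepsilon_s}E$ be its completion. For $X\in L_k(\Omega;E)$ let $\mathbb M^k_\varepsilon[X]=\mathbb E[{\otimes^k}X]\in\otimes^{k,s}_{\varepsilon_s}E$ (Bochner integral) be its injective $k$th moment. For a Banach space $F$ and $r\in[1,\infty)$, $\|\eta\|_{L_r(\Omega;F)}=(\mathbb E\|\eta\|_F^r)^{1/r}$.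 Constants. A Rademacher family $(r_j)_{j\in\mathbb N}$ consists of independent random variables on a complete probability space $\widetilde\Omega$ that take the values $\pm1$ with probability $\frac12$ each. $E$ has (Rademacher) type $p\in[1,2]$ if there is a $\tau\in(0,\infty)$ such that $\|\sum_{j=1}^nr_jx_j\|_{L_p(\widetilde\Omega;E)}\le\tau(\sum_{j=1}^n\|x_j\|_E^p)^{1/p}$ for all Rademacher families, all $n$ and all $x_1,\dots,x_n\in E$; $\tau_p(E)$ is the infimum of such $\tau$. $K_{q,p}$ is the infimum of the $K\in(0,\infty)$ such that $\|\sum_{j=1}^nr_jx_j\|_{L_q(\widetilde\Omega;F)}\le K\|\sum_{j=1}^nr_jx_j\|_{L_p(\widetilde\Omega;F)}$ for all Rademacher families, all real Banach spaces $F$, all $n$ and all $x_1,\dots,x_n\in F$. $B_q$ is the infimum of the $B\in(0,\infty)$ such that $\|\sum_{j=1}^nr_ja_j\|_{L_q(\widetilde\Omega;\mathbb R)}\le B(\sum_{j=1}^na_j^2)^{1/2}$ for all Rademacher families, all $n$ and all $a_1,\dots,a_n\in\mathbb R$. Set $$C^{\rm diff}_{q,p,k}=16\,k\,\sqrt\pi\,K_{q,p}\,\tau_p(E)\,K_{q,2},\qquad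 C^{\rm ML}_{q,p,k}=2\max\{C^{\rm diff}_{q,p,k},B_q\}.$$ **Theorem.** Let $E$ be of Rademacher type $p\in[1,2]$, $q\in[p,\infty)$ and $k,L\in\mathbb N$. For every $\ell\in\{1,\dots,L\}$ let $X_\ell\in L_{kq}(\Omega;E)$ and $M_\ell\in\mathbb N$, and set $X_0:=0$. Then $\xi_\ell:={\otimes^k}X_\ell-{\otimes^k}X_{\ell-1}\in L_q(\Omega;\otimes^{k,s}_{\varepsilon_s}E)$ for every $\ell\in\{1,\dots,L\}$, and $\mathbb M^k_\varepsilon[X_L]$ exists. If, for every $\ell$, $\xi_{\ell,1},\dots,\xi_{\ell,M_\ell}$ are independent copies of $\xi_\ell$ on $\Omega$ (no independence between different levels is assumed), then for every $U\in\otimes^{k,s}_{\varepsilon_s}E$ the random variable $U-\sum_{\ell=1}^L\frac1{M_\ell}\sum_{j=1}^{M_\ell}\xi_{\ell,j}$ belongs to $L_q(\Omega;\otimes^{k,s}_{\varepsilon_s}E)$ and $$\Bigl\|U-\sum_{\ell=1}^L\frac1{M_\ell}\sum_{j=1}^{M_\ell}\xi_{\ell,j}\Bigr\|_{L_q(\Omega;\otimes^{k,s}_{\varepsilon_s}E)}\le\bigl\|U-\mathbb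 M^k_\varepsilon[X_L]\bigr\|_{\varepsilon_s}$$ $$+\,C^{\rm ML}_{q,p,k}\sum_{\ell=1}^L\Bigl[M_\ell^{-(1-\frac1p)}\|X_\ell-X_{\ell-1}\|_{L_{kq}(\Omega;E)}\sum_{i=0}^{k-1}\Bigl(\tbinom{k}{i+1}\|X_\ell-X_{\ell-1}\|_{L_{kq}(\Omega;E)}^i+\|X_\ell\|_{L_k(\Omega;E)}^i\Bigr)\|X_{\ell-1}\|_{L_{kq}(\Omega;E)}^{k-i-1}\Bigr],$$ with the convention $0^0=1$. -/

import Mathlib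

open MeasureTheory ProbabilityTheory
open scoped ENNReal TensorProduct Nat

universe u v

noncomputable section

/-! ### The `k`-fold symmetric injective tensor product -/

section SymmetricTensors

variable {E : Type u} [NormedAddCommGroup E] [NormedSpace ℝ E]

/-- The symmetrization `(1/k!) ∑_σ x_{σ(1)} ⊗ ⋯ ⊗ x_{σ(k)}` of `x_1 ⊗ ⋯ ⊗ x_k`. -/
def symmetrize (k : ℕ) (x : Fin k → E) : ⨂[ℝ] _ : Fin k, E :=
  ((k ! : ℕ) : ℝ)⁻¹ • ∑ σ : Equiv.Perm (Fin k), ⨂ₜ[ℝ] i : Fin k, x (σ i)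

variable (E) in
/-- The symmetric elements of the algebraic tensor product `E ⊗ ⋯ ⊗ E` (`k` factors):
the linear span of all symmetrizations. -/
def symTensorSubmodule (k : ℕ) : Submodule ℝ (⨂[ℝ] _ : Fin k, E) :=
  Submodule.span ℝ (Set.range (symmetrize (E := E) k))

variable (E) in
/-- The `k`-fold symmetric algebraic tensor product of `E`.  This is a type of its own, so that it
carries the symmetric injective tensor norm defined below and no other. -/
def SymTensor (k : ℕ) : Type u := symTensorSubmodule E k

namespace SymTensor

instance (k : ℕ) : AddCommGroup (SymTensor E k) :=
  inferInstanceAs (AddCommGroup (symTensorSubmodule E k))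

instance (k : ℕ) : Module ℝ (SymTensor E k) :=
  inferInstanceAs (Module ℝ (symTensorSubmodule E k))

variable (E) in
/-- The inclusion of the symmetric into the full algebraic tensor product. -/
def incl (k : ℕ) : SymTensor E k →ₗ[ℝ] ⨂[ℝ] _ : Fin k, E :=
  (symTensorSubmodule E k).subtype

/-- The linear functional `f ⊗ ⋯ ⊗ f` on the algebraic tensor product, with
`(f ⊗ ⋯ ⊗ f) (x_1 ⊗ ⋯ ⊗ x_k) = ∏ f (x_n)`. -/
def dualPow (k : ℕ) (f : StrongDual ℝ E) : (⨂[ℝ] _ : Fin k, E) →ₗ[ℝ] ℝ :=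
  PiTensorProduct.lift
    ((MultilinearMap.mkPiAlgebra ℝ (Fin k) ℝ).compLinearMap fun _ => f.toLinearMap)

@[simp]
theorem dualPow_tprod (k : ℕ) (f : StrongDual ℝ E) (x : Fin k → E) :
    dualPow k f (⨂ₜ[ℝ] i, x i) = ∏ i, f (x i) := by
  simp [dualPow]

theorem bddAbove_dualPow (k : ℕ) (U : ⨂[ℝ] _ : Fin k, E) :
    BddAbove (Set.range fun f : Metric.closedBall (0 : StrongDual ℝ E) 1 => |dualPow k f U|) := by
  induction U using PiTensorProduct.induction_on with
  | smul_tprod r x =>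
    refine ⟨|r| * ∏ i, ‖x i‖, ?_⟩
    rintro _ ⟨f, rfl⟩
    have hf : ‖(f : StrongDual ℝ E)‖ ≤ 1 := mem_closedBall_zero_iff.1 f.2
    simp only [map_smul, dualPow_tprod, smul_eq_mul, abs_mul, Finset.abs_prod]
    gcongr with i
    have h := (f : StrongDual ℝ E).le_of_opNorm_le hf (x i)
    simpa using h
  | add x y hx hy =>
    obtain ⟨a, ha⟩ := hx
    obtain ⟨b, hb⟩ := hy
    refine ⟨a + b, ?_⟩
    rintro _ ⟨f, rfl⟩
    simp only [map_add]
    exact (abs_add_le _ _).trans (add_le_add (ha ⟨f, rfl⟩) (hb ⟨f, rfl⟩))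

/-- The symmetric injective tensor norm: `‖U‖ = sup {|(f ⊗ ⋯ ⊗ f) U| : ‖f‖ ≤ 1}`. -/
instance (k : ℕ) : Norm (SymTensor E k) :=
  ⟨fun U => ⨆ f : Metric.closedBall (0 : StrongDual ℝ E) 1, |dualPow k f (incl E k U)|⟩

theorem norm_def (k : ℕ) (U : SymTensor E k) :
    ‖U‖ = ⨆ f : Metric.closedBall (0 : StrongDual ℝ E) 1, |dualPow k f (incl E k U)| := rfl

theorem core (k : ℕ) : SeminormedSpace.Core ℝ (SymTensor E k) where
  norm_nonneg U := Real.iSup_nonneg fun _ => abs_nonneg _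
  norm_smul c U := by
    simp only [norm_def, map_smul, smul_eq_mul, abs_mul, Real.norm_eq_abs]
    exact (Real.mul_iSup_of_nonneg (abs_nonneg c) _).symm
  norm_triangle U V := by
    have : Nonempty (Metric.closedBall (0 : StrongDual ℝ E) 1) := ⟨⟨0, by simp⟩⟩
    refine ciSup_le fun f => ?_
    rw [map_add, map_add]
    exact (abs_add_le _ _).trans (add_le_add
      (le_ciSup (bddAbove_dualPow k (incl E k U)) f)
      (le_ciSup (bddAbove_dualPow k (incl E k V)) f))

instance (k : ℕ) : SeminormedAddCommGroup (SymTensor E k) :=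
  SeminormedAddCommGroup.ofCore (core k)

instance (k : ℕ) : NormedSpace ℝ (SymTensor E k) where
  norm_smul_le c U := ((core k).norm_smul c U).le

/-- `⊗ᵏ x = x ⊗ ⋯ ⊗ x` as an element of the symmetric algebraic tensor product. -/
def pow (k : ℕ) (x : E) : SymTensor E k :=
  ⟨⨂ₜ[ℝ] _ : Fin k, x, by
    refine Submodule.subset_span ⟨fun _ => x, ?_⟩
    have hk : ((k ! : ℕ) : ℝ) ≠ 0 := Nat.cast_ne_zero.2 (Nat.factorial_ne_zero k)
    simp only [symmetrize, Finset.sum_const, Finset.card_univ, Fintype.card_perm,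
      Fintype.card_fin]
    rw [← Nat.cast_smul_eq_nsmul ℝ, smul_smul, inv_mul_cancel₀ hk, one_smul]⟩

/-- The norm of `∑ λ_j ⊗ᵏ x_j` is `sup {|∑ λ_j f(x_j)ᵏ| : ‖f‖ ≤ 1}`. -/
theorem norm_sum_pow (k M : ℕ) (c : Fin M → ℝ) (x : Fin M → E) :
    ‖∑ j, c j • pow k (x j)‖ =
      ⨆ f : Metric.closedBall (0 : StrongDual ℝ E) 1,
        |∑ j, c j * (f : StrongDual ℝ E) (x j) ^ k| := by
  have h : ∀ y : E, incl E k (pow k y) = ⨂ₜ[ℝ] _ : Fin k, y := fun _ => rfl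
  simp only [norm_def, map_sum, map_smul, h, dualPow_tprod, smul_eq_mul, Finset.prod_const,
    Finset.card_univ, Fintype.card_fin]

end SymTensor

variable (E) in
/-- The `k`-fold symmetric injective tensor product of `E`: the completion of the symmetric
algebraic tensor product in the symmetric injective tensor norm. -/
abbrev SymInjTensor (k : ℕ) : Type u := UniformSpace.Completion (SymTensor E k)

instance (k : ℕ) : MeasurableSpace (SymInjTensor E k) := borel _

instance (k : ℕ) : BorelSpace (SymInjTensor E k) := ⟨rfl⟩

/-- `⊗ᵏ x` in the symmetric injective tensor product. -/
def tensorPow (k : ℕ) (x : E) : SymInjTensor E k := (SymTensor.pow k x : SymTensor E k)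

/-- The injective `k`th moment: the Bochner integral of `⊗ᵏ X`. -/
def injMoment {Ω : Type v} [MeasurableSpace Ω] (k : ℕ) (X : Ω → E) (P : Measure Ω) :
    SymInjTensor E k :=
  ∫ ω, tensorPow k (X ω) ∂P

end SymmetricTensors

/-! ### Rademacher families, type, and the constants -/

/-- The `L_r`-norm `(𝔼 ‖f‖ ^ r) ^ (1 / r)` as a real number, for real `r ≥ 1`. -/
def lrNorm {Ω : Type*} [MeasurableSpace Ω] {F : Type*} [NormedAddCommGroup F]
    (r : ℝ) (f : Ω → F) (μ : Measure Ω) : ℝ :=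
  (eLpNorm f (ENNReal.ofReal r) μ).toReal

/-- Independent random variables `r_0, r_1, …` that are `±1` with probability `1/2` each. -/
structure IsRademacherFamily {Ω : Type*} [MeasurableSpace Ω] (r : ℕ → Ω → ℝ) (μ : Measure Ω) :
    Prop where
  measurable : ∀ j, Measurable (r j)
  values : ∀ j ω, r j ω = -1 ∨ r j ω = 1
  indep : iIndepFun r μ
  prob_neg : ∀ j, μ {ω | r j ω = -1} = 1 / 2
  prob_pos : ∀ j, μ {ω | r j ω = 1} = 1 / 2

/-- `K > 0` satisfies the `(q, p)` Kahane–Khintchine inequality, in all real Banach spaces. -/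
def IsKahaneKhintchineBound (q p K : ℝ) : Prop :=
  0 < K ∧ ∀ (S : Type) [MeasurableSpace S] (μ : Measure S) [IsProbabilityMeasure μ]
    [μ.IsComplete] (r : ℕ → S → ℝ), IsRademacherFamily r μ →
    ∀ (F : Type u) [NormedAddCommGroup F] [NormedSpace ℝ F] [CompleteSpace F]
      (n : ℕ) (x : ℕ → F),
      lrNorm q (fun ω => ∑ j ∈ Finset.range n, r j ω • x j) μ ≤
        K * lrNorm p (fun ω => ∑ j ∈ Finset.range n, r j ω • x j) μ

/-- The `(q, p)` Kahane–Khintchine constant `K_{q,p}`. -/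
def kahaneKhintchineConst (q p : ℝ) : ℝ :=
  sInf {K : ℝ | IsKahaneKhintchineBound.{u} q p K}

/-- `τ > 0` satisfies the Rademacher type `p` inequality in `F`. -/
def IsTypeBound (F : Type u) [NormedAddCommGroup F] [NormedSpace ℝ F] (p τ : ℝ) : Prop :=
  0 < τ ∧ ∀ (S : Type) [MeasurableSpace S] (μ : Measure S) [IsProbabilityMeasure μ]
    [μ.IsComplete] (r : ℕ → S → ℝ), IsRademacherFamily r μ →
    ∀ (n : ℕ) (x : ℕ → F),
      lrNorm p (fun ω => ∑ j ∈ Finset.range n, r j ω • x j) μ ≤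
        τ * (∑ j ∈ Finset.range n, ‖x j‖ ^ p) ^ (1 / p)

/-- `F` has (Rademacher) type `p ∈ [1, 2]`. -/
def HasRademacherType (F : Type u) [NormedAddCommGroup F] [NormedSpace ℝ F] (p : ℝ) : Prop :=
  p ∈ Set.Icc (1 : ℝ) 2 ∧ ∃ τ : ℝ, IsTypeBound F p τ

/-- The type `p` constant `τ_p(F)`. -/
def typeConst (F : Type u) [NormedAddCommGroup F] [NormedSpace ℝ F] (p : ℝ) : ℝ :=
  sInf {τ : ℝ | IsTypeBound F p τ}

/-- `B > 0` satisfies the upper Khintchine inequality with exponent `q`. -/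
def IsKhintchineBound (q B : ℝ) : Prop :=
  0 < B ∧ ∀ (S : Type) [MeasurableSpace S] (μ : Measure S) [IsProbabilityMeasure μ]
    [μ.IsComplete] (r : ℕ → S → ℝ), IsRademacherFamily r μ →
    ∀ (n : ℕ) (a : ℕ → ℝ),
      lrNorm q (fun ω => ∑ j ∈ Finset.range n, r j ω * a j) μ ≤
        B * (∑ j ∈ Finset.range n, a j ^ 2) ^ (1 / 2 : ℝ)

/-- The Khintchine constant `B_q`, i.e. the smallest constant in the upper Khintchine
inequality. -/
def khintchineConst (q : ℝ) : ℝ := sInf {B : ℝ | IsKhintchineBound q B}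

/-- `C^diff_{q,p,k} = 16 k √π K_{q,p} τ_p(E) K_{q,2}`. -/
def diffConst (E : Type u) [NormedAddCommGroup E] [NormedSpace ℝ E] (q p : ℝ) (k : ℕ) : ℝ :=
  16 * k * Real.sqrt Real.pi * kahaneKhintchineConst.{u} q p * typeConst E p *
    kahaneKhintchineConst.{u} q 2

/-- `C^ML_{q,p,k} = 2 max {C^diff_{q,p,k}, B_q}`. -/
def mlConst (E : Type u) [NormedAddCommGroup E] [NormedSpace ℝ E] (q p : ℝ) (k : ℕ) : ℝ :=
  2 * max (diffConst E q p k) (khintchineConst q)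

end

/-!
Telescoping over the levels and the triangle inequality reduce the claim to the Monte Carlo error
`𝔼 ζ - (1 / n) ∑ ζ_j` of a single level `ζ = ⊗ᵏX - ⊗ᵏY`, and symmetrization bounds that error by
twice the Rademacher norm of the `⊗ᵏX_j - ⊗ᵏY_j`. On the unit ball of the dual this norm becomes the
supremum of a Rademacher process with summands `f ↦ f(x)ᵏ - f(y)ᵏ`. Their increments are dominated
by the sum of those of `f ↦ a f(x - y)` and `f ↦ b f(y)`, for suitable weights `a` and `b`, so a
two-process version of Talagrand's contraction principle replaces the process by Rademacher sums of
vectors of `E`, to which the type inequality applies. Minkowski's inequality in `L_{q/p}` and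
Hölder's inequality lead back to the norms of `X - Y` and `Y`.

Contraction is an `L_1` statement and costs a factor `8`. The Kahane–Khintchine constant `K_{q,2}`
brings `L_q` down to `L_2`, and hypercontractivity brings `L_2` down to `L_1` at the price of a
factor `3`. The total `2 * 3 * 8 = 48` is at most `32 √π`.
-/

section RademacherNorm

open scoped BigOperators

/-- The Rademacher sum `∑ ε_i x_i`, as a function of the signs `ε`. -/
def signSum {F : Type*} [AddCommGroup F] {n : ℕ} (x : Fin n → F) (ε : Fin n → ℤˣ) : F :=
  ∑ i, ε i • x i

/-- The `L_q`-norm `(𝔼 ‖∑ ε_i x_i‖ ^ q) ^ (1 / q)` of a Rademacher sum, realized on the finite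
probability space of all choices of signs. -/
noncomputable def radNorm {F : Type*} [NormedAddCommGroup F] (q : ℝ) {n : ℕ} (x : Fin n → F) : ℝ :=
  (𝔼 ε, ‖signSum x ε‖ ^ q) ^ q⁻¹

theorem signSum_cons {F : Type*} [AddCommGroup F] {n : ℕ} (x : Fin (n + 1) → F) (s : ℤˣ)
    (ε : Fin n → ℤˣ) : signSum x (Fin.cons s ε) = s • x 0 + signSum (Fin.tail x) ε := by
  simp [signSum, Fin.sum_univ_succ, Fin.tail]

theorem map_signSum {F G H : Type*} [AddCommGroup F] [AddCommGroup G] [FunLike H F G]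
    [AddMonoidHomClass H F G] (T : H) {n : ℕ} (x : Fin n → F) (ε : Fin n → ℤˣ) :
    T (signSum x ε) = signSum (fun i => T (x i)) ε := by
  simp [signSum, Units.smul_def]

theorem expect_units_int {R : Type*} [Field R] [CharZero R] (h : ℤˣ → R) :
    𝔼 s, h s = (h 1 + h (-1)) / 2 := by
  rw [Fintype.expect_eq_sum_div_card]
  simp [UnitsInt.univ]

theorem expect_signs_succ {R : Type*} [Field R] [CharZero R] {n : ℕ}
    (g : (Fin (n + 1) → ℤˣ) → R) :
    𝔼 ε, g ε = (𝔼 ε, g (Fin.cons 1 ε) + 𝔼 ε, g (Fin.cons (-1) ε)) / 2 := by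
  rw [← expect_units_int fun s => 𝔼 ε, g (Fin.cons s ε), ← Finset.expect_product',
    Finset.univ_product_univ]
  exact Fintype.expect_equiv (Fin.consEquiv fun _ => ℤˣ).symm _ _ fun ε => by simp [Fin.consEquiv]

theorem radNorm_one {F : Type*} [NormedAddCommGroup F] {n : ℕ} (x : Fin n → F) :
    radNorm 1 x = 𝔼 ε, ‖signSum x ε‖ := by
  simp [radNorm]

theorem radNorm_natCast_pow {F : Type*} [NormedAddCommGroup F] {m n : ℕ} (hm : m ≠ 0)
    (x : Fin n → F) : radNorm m x ^ m = 𝔼 ε, ‖signSum x ε‖ ^ m := by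
  simp only [radNorm, Real.rpow_natCast]
  exact Real.rpow_inv_natCast_pow (Finset.expect_nonneg fun _ _ => by positivity) hm

theorem radNorm_nonneg {F : Type*} [NormedAddCommGroup F] (q : ℝ) {n : ℕ} (x : Fin n → F) :
    0 ≤ radNorm q x :=
  Real.rpow_nonneg (Finset.expect_nonneg fun _ _ => by positivity) _

end RademacherNorm

section RademacherFamily

open scoped BigOperators

theorem lrNorm_mono_exponent {S F : Type*} [MeasurableSpace S] {μ : Measure S}
    [IsProbabilityMeasure μ] [NormedAddCommGroup F] {f : S → F} {r s : ℝ} (hrs : r ≤ s)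
    (hf : MemLp f (ENNReal.ofReal s) μ) : lrNorm r f μ ≤ lrNorm s f μ :=
  ENNReal.toReal_mono hf.eLpNorm_ne_top
    (eLpNorm_le_eLpNorm_of_exponent_le (ENNReal.ofReal_le_ofReal hrs) hf.aestronglyMeasurable)

instance : MeasurableSingletonClass ℤˣ where
  measurableSet_singleton s := ⟨{(s : ℤ)}, measurableSet_singleton _, by ext; simp [Units.ext_iff]⟩

namespace IsRademacherFamily

variable {S : Type*} [MeasurableSpace S] {μ : Measure S} {r : ℕ → S → ℝ}
  {F : Type*} [NormedAddCommGroup F]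

theorem exists_signs (h : IsRademacherFamily r μ) (n : ℕ) :
    ∃ e : S → Fin n → ℤˣ, Measurable e ∧ (∀ ω (i : Fin n), r i ω = ((e ω i : ℤ) : ℝ)) ∧
      ∀ ε, μ.real (e ⁻¹' {ε}) = (2 ^ n)⁻¹ := by
  let sign : ℝ → ℤˣ := fun t => if t = 1 then 1 else -1
  have hsign : Measurable sign :=
    Measurable.ite (measurableSet_singleton 1) measurable_const measurable_const
  have hr : ∀ i ω, r i ω = ((sign (r i ω) : ℤ) : ℝ) := fun i ω => by
    rcases h.values i ω with hi | hi <;> simp [sign, hi]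
    norm_num
  have hlaw : ∀ i s, μ (sign ∘ r i ⁻¹' {s}) = 2⁻¹ := fun i s => by
    have hpre : sign ∘ r i ⁻¹' {s} = {ω | r i ω = ((s : ℤ) : ℝ)} := by
      ext ω
      simp only [Set.mem_preimage, Set.mem_singleton_iff, Function.comp_apply, Set.mem_ofPred_eq]
      rw [hr i ω]
      norm_cast
      rw [← hr i ω]
    rcases Int.units_eq_one_or s with rfl | rfl
    · simpa [hpre] using h.prob_pos i
    · simpa [hpre] using h.prob_neg i
  refine ⟨fun ω i => sign (r i ω), measurable_pi_lambda _ fun i => hsign.comp (h.measurable i),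
    fun ω i => hr i ω, fun ε => ?_⟩
  have hindep : iIndepFun (fun i : Fin n => sign ∘ r i) μ :=
    (h.indep.precomp Fin.val_injective).comp _ fun _ => hsign
  have hpre : (fun ω (i : Fin n) => sign (r i ω)) ⁻¹' {ε} =
      ⋂ i ∈ (Finset.univ : Finset (Fin n)), sign ∘ r i ⁻¹' {ε i} := by
    ext ω; simp [funext_iff]
  rw [Measure.real, hpre, hindep.measure_inter_preimage_eq_mul _ (sets := fun i => {ε i})
    fun i _ => measurableSet_singleton _]
  simp [hlaw]

variable [NormedSpace ℝ F]

theorem memLp_sum_smul [IsFiniteMeasure μ] (h : IsRademacherFamily r μ) (n : ℕ) (x : ℕ → F)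
    (q : ℝ≥0∞) : MemLp (fun ω => ∑ j ∈ Finset.range n, r j ω • x j) q μ := by
  refine memLp_finsetSum _ fun j _ => MemLp.of_bound
    ((h.measurable j).aestronglyMeasurable.smul_const _) ‖x j‖ (.of_forall fun ω => ?_)
  rcases h.values j ω with hj | hj <;> simp [hj]

theorem lrNorm_eq_radNorm [IsFiniteMeasure μ] (h : IsRademacherFamily r μ) {q : ℝ} (hq : 0 < q)
    (n : ℕ) (x : ℕ → F) :
    lrNorm q (fun ω => ∑ j ∈ Finset.range n, r j ω • x j) μ = radNorm q fun i : Fin n => x i := by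
  obtain ⟨e, he, hre, hlaw⟩ := h.exists_signs n
  have hsum : ∀ ω, ∑ j ∈ Finset.range n, r j ω • x j = signSum (fun i : Fin n => x i) (e ω) :=
    fun ω => by simp [Finset.sum_range, signSum, hre, Units.smul_def, Int.cast_smul_eq_zsmul]
  rw [lrNorm, (h.memLp_sum_smul n x _).eLpNorm_eq_integral_rpow_norm (by simpa using hq) (by simp),
    ENNReal.toReal_ofReal hq.le, ENNReal.toReal_ofReal (by positivity), radNorm]
  congr 1
  simp_rw [hsum]
  rw [← integral_map he.aemeasurable (f := fun ε => ‖signSum (fun i : Fin n => x i) ε‖ ^ q)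
    (measurable_of_finite _).aestronglyMeasurable, integral_fintype .of_finite,
    Fintype.expect_eq_sum_div_card, Finset.sum_div]
  refine Finset.sum_congr rfl fun ε _ => ?_
  rw [map_measureReal_apply he (measurableSet_singleton ε), hlaw]
  simp [div_eq_inv_mul]

theorem completion (h : IsRademacherFamily r μ) :
    IsRademacherFamily (Ω := NullMeasurableSpace S μ) r μ.completion where
  measurable j _ ht := (h.measurable j ht).nullMeasurableSet
  values := h.values
  indep := (iIndepFun_iff_measure_inter_preimage_eq_mul (Ω := NullMeasurableSpace S μ)
    (μ := μ.completion)).2 fun T _ hs => h.indep.measure_inter_preimage_eq_mul (S := T) hs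
  prob_neg := h.prob_neg
  prob_pos := h.prob_pos

end IsRademacherFamily

theorem exists_isRademacherFamily :
    ∃ (S : Type) (_ : MeasurableSpace S) (μ : Measure S) (r : ℕ → S → ℝ),
      IsProbabilityMeasure μ ∧ μ.IsComplete ∧ IsRademacherFamily r μ := by
  let ν : Measure Bool := (PMF.uniformOfFintype Bool).toMeasure
  let sign : Bool → ℝ := fun b => if b then 1 else -1
  let μ : Measure (ℕ → Bool) := Measure.infinitePi fun _ => ν
  let r : ℕ → (ℕ → Bool) → ℝ := fun j ω => sign (ω j)
  have hlaw : ∀ j b, μ {ω | ω j = b} = 1 / 2 := fun j b => by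
    refine ((measurePreserving_eval_infinitePi (fun _ : ℕ => ν) j).measure_preimage
      (measurableSet_singleton b).nullMeasurableSet).trans ?_
    simp [ν]
  have hr : IsRademacherFamily r μ :=
    { measurable := fun j => (measurable_of_countable sign).comp (measurable_pi_apply j)
      values := fun j ω => by cases h : ω j <;> simp [r, sign, h]
      indep := iIndepFun_infinitePi (P := fun _ : ℕ => ν) (X := fun _ => sign)
        fun _ => measurable_of_countable sign
      prob_neg := fun j => by
        rw [← hlaw j false]
        congr 1 with ω
        cases h : ω j <;> simp [r, sign, h]; norm_num
      prob_pos := fun j => by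
        rw [← hlaw j true]
        congr 1 with ω
        cases h : ω j <;> simp [r, sign, h]; norm_num }
  exact ⟨NullMeasurableSpace (ℕ → Bool) μ, _, μ.completion, r, ⟨measure_univ (μ := μ)⟩,
    inferInstance, hr.completion⟩

theorem exists_nat_extension {F : Type*} [Zero F] {n : ℕ} (x : Fin n → F) :
    ∃ y : ℕ → F, (fun i : Fin n => y i) = x :=
  ⟨fun j => if h : j < n then x ⟨j, h⟩ else 0, by ext i; simp⟩

theorem radNorm_mono_exponent {F : Type*} [NormedAddCommGroup F] [NormedSpace ℝ F] {r s : ℝ}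
    (hr : 0 < r) (hrs : r ≤ s) {n : ℕ} (x : Fin n → F) : radNorm r x ≤ radNorm s x := by
  obtain ⟨S, _, μ, ρ, _, _, hρ⟩ := exists_isRademacherFamily
  obtain ⟨y, rfl⟩ := exists_nat_extension x
  rw [← hρ.lrNorm_eq_radNorm hr, ← hρ.lrNorm_eq_radNorm (hr.trans_le hrs)]
  exact lrNorm_mono_exponent hrs (hρ.memLp_sum_smul n y _)

end RademacherFamily

section Hypercontractivity

open scoped BigOperators

theorem choose_two_mul_le (m i : ℕ) :
    (2 * m).choose (2 * i) ≤ (2 * m - 1) ^ i * m.choose i := by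
  induction i with
  | zero => simp
  | succ i ih =>
    have hodd : 2 * m - (2 * i + 1) ≤ (2 * m - 1) * (2 * i + 1) := by
      calc 2 * m - (2 * i + 1) ≤ (2 * m - 1) * 1 := by omega
        _ ≤ _ := Nat.mul_le_mul_left _ (by omega)
    refine le_of_mul_le_mul_right ?_ (show 0 < (2 * i + 2) * (2 * i + 1) by positivity)
    calc (2 * m).choose (2 * (i + 1)) * ((2 * i + 2) * (2 * i + 1))
        = (2 * m).choose (2 * i) * (2 * (m - i)) * (2 * m - (2 * i + 1)) := by
          rw [← mul_assoc, show 2 * (i + 1) = 2 * i + 1 + 1 by ring, Nat.choose_succ_right_eq,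
            mul_right_comm, Nat.choose_succ_right_eq, ← Nat.mul_sub 2 m i]
      _ ≤ (2 * m - 1) ^ i * m.choose i * (2 * (m - i)) * ((2 * m - 1) * (2 * i + 1)) := by gcongr
      _ = (2 * m - 1) ^ (i + 1) * (m.choose i * (m - i)) * 2 * (2 * i + 1) := by ring
      _ = (2 * m - 1) ^ (i + 1) * m.choose (i + 1) * ((2 * i + 2) * (2 * i + 1)) := by
          rw [← Nat.choose_succ_right_eq]; ring

theorem sum_range_even {M : Type*} [AddCommMonoid M] {f : ℕ → M}
    (hf : ∀ i, f (2 * i + 1) = 0) (m : ℕ) :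
    ∑ j ∈ Finset.range (2 * m + 1), f j = ∑ i ∈ Finset.range (m + 1), f (2 * i) := by
  induction m with
  | zero => simp
  | succ m ih =>
    rw [Finset.sum_range_succ _ (m + 1), ← ih, show 2 * (m + 1) + 1 = 2 * m + 1 + 1 + 1 by ring,
      Finset.sum_range_succ, Finset.sum_range_succ, hf, add_zero]
    rfl

theorem half_add_pow_add_sub_pow {R : Type*} [Field R] [CharZero R] (u v : R) (m : ℕ) :
    ((u + v) ^ (2 * m) + (u - v) ^ (2 * m)) / 2 =
      ∑ i ∈ Finset.range (m + 1), (v ^ 2) ^ i * (u ^ 2) ^ (m - i) * (2 * m).choose (2 * i) := by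
  rw [add_comm u, sub_eq_neg_add, add_pow, add_pow, ← Finset.sum_add_distrib, Finset.sum_div,
    sum_range_even fun i => by rw [(odd_two_mul_add_one i).neg_pow]; ring]
  refine Finset.sum_congr rfl fun i _ => ?_
  rw [(even_two_mul i).neg_pow, add_self_div_two, ← Nat.mul_sub, pow_mul, pow_mul]

theorem hypercontractive_two_point {m : ℕ} {ρ : ℝ} (hρ : ((2 * m - 1 : ℕ) : ℝ) * ρ ^ 2 ≤ 1)
    (u v : ℝ) :
    ((u + ρ * v) ^ (2 * m) + (u - ρ * v) ^ (2 * m)) / 2 ≤ (u ^ 2 + v ^ 2) ^ m := by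
  rw [half_add_pow_add_sub_pow, add_comm (u ^ 2), add_pow]
  refine Finset.sum_le_sum fun i _ => ?_
  have hchoose : ((2 * m).choose (2 * i) : ℝ) ≤ ((2 * m - 1 : ℕ) : ℝ) ^ i * m.choose i := by
    exact_mod_cast choose_two_mul_le m i
  calc ((ρ * v) ^ 2) ^ i * (u ^ 2) ^ (m - i) * (2 * m).choose (2 * i)
      ≤ ((ρ * v) ^ 2) ^ i * (u ^ 2) ^ (m - i) * (((2 * m - 1 : ℕ) : ℝ) ^ i * m.choose i) := by
        gcongr
    _ = ((2 * m - 1 : ℕ) * ρ ^ 2) ^ i * ((v ^ 2) ^ i * (u ^ 2) ^ (m - i) * m.choose i) := by ring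
    _ ≤ _ := mul_le_of_le_one_left (by positivity) (pow_le_one₀ (by positivity) hρ)

theorem half_sum_pow_le {ι : Type*} [Fintype ι] {m : ℕ} (hm : m ≠ 0) {g h B : ι → ℝ}
    (hg : ∀ i, 0 ≤ g i) (hh : ∀ i, 0 ≤ h i) (hB : ∀ i, 0 ≤ B i)
    (hghB : ∀ i, (g i ^ m + h i ^ m) / 2 ≤ B i ^ m) :
    ((∑ i, g i) ^ m + (∑ i, h i) ^ m) / 2 ≤ (∑ i, B i) ^ m := by
  have hfact : Fact (1 ≤ (m : ℝ≥0∞)) := ⟨by exact_mod_cast Nat.one_le_iff_ne_zero.2 hm⟩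
  let z : ι → PiLp m fun _ : Fin 2 => ℝ := fun i => WithLp.toLp m ![g i, h i]
  have hnorm : ∀ y : PiLp m fun _ : Fin 2 => ℝ, ‖y‖ ^ m = |y 0| ^ m + |y 1| ^ m := fun y => by
    rw [PiLp.norm_eq_of_nat m rfl, one_div, Real.rpow_inv_natCast_pow (by positivity) hm]
    simp
  have hz : ∀ i, ‖z i‖ ≤ (2 : ℝ) ^ (m : ℝ)⁻¹ * B i := fun i => by
    refine le_of_pow_le_pow_left₀ hm (mul_nonneg (by positivity) (hB i)) ?_
    rw [hnorm, mul_pow, Real.rpow_inv_natCast_pow two_pos.le hm]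
    simpa [z, abs_of_nonneg (hg i), abs_of_nonneg (hh i)] using
      (div_le_iff₀' two_pos).1 (hghB i)
  have hsum : ‖∑ i, z i‖ ^ m ≤ ((2 : ℝ) ^ (m : ℝ)⁻¹ * ∑ i, B i) ^ m := by
    rw [Finset.mul_sum]
    gcongr
    exact (norm_sum_le _ _).trans (Finset.sum_le_sum fun i _ => hz i)
  rw [hnorm, mul_pow, Real.rpow_inv_natCast_pow two_pos.le hm] at hsum
  simpa [z, div_le_iff₀', abs_of_nonneg, Finset.sum_nonneg, hg, hh] using hsum

variable {F : Type*} [NormedAddCommGroup F] [NormedSpace ℝ F]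

theorem norm_add_smul_le {ρ : ℝ} (hρ : |ρ| ≤ 1) (a b : F) :
    ‖a + ρ • b‖ ≤ (‖a + b‖ + ‖a - b‖) / 2 + ρ * ((‖a + b‖ - ‖a - b‖) / 2) := by
  obtain ⟨hρ₁, hρ₂⟩ := abs_le.1 hρ
  calc ‖a + ρ • b‖ = ‖((1 + ρ) / 2) • (a + b) + ((1 - ρ) / 2) • (a - b)‖ := by
        congr 1; module
    _ ≤ (1 + ρ) / 2 * ‖a + b‖ + (1 - ρ) / 2 * ‖a - b‖ := by
        refine (norm_add_le _ _).trans_eq ?_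
        rw [norm_smul, norm_smul, Real.norm_of_nonneg (by linarith),
          Real.norm_of_nonneg (by linarith)]
    _ = _ := by ring

theorem hypercontractive_two_point_norm {m : ℕ} (hm : m ≠ 0) {ρ : ℝ}
    (hρ : ((2 * m - 1 : ℕ) : ℝ) * ρ ^ 2 ≤ 1) (a b : F) :
    (‖a + ρ • b‖ ^ (2 * m) + ‖a - ρ • b‖ ^ (2 * m)) / 2 ≤
      ((‖a + b‖ ^ 2 + ‖a - b‖ ^ 2) / 2) ^ m := by
  have hρ₁ : |ρ| ≤ 1 := by
    have : (1 : ℝ) ≤ (2 * m - 1 : ℕ) := by exact_mod_cast (by omega : 1 ≤ 2 * m - 1)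
    rw [← sq_le_one_iff_abs_le_one]
    nlinarith [sq_nonneg ρ]
  have hadd := norm_add_smul_le hρ₁ a b
  have hsub := norm_add_smul_le ((abs_neg ρ).trans_le hρ₁) a b
  rw [neg_smul, ← sub_eq_add_neg, neg_mul, ← sub_eq_add_neg] at hsub
  calc _ ≤ _ := by gcongr
    _ ≤ _ := hypercontractive_two_point hρ _ _
    _ = _ := by ring

/-- The induction peels off one sign; the two-point inequality for it is combined with the
remaining signs by Minkowski's inequality in `ℓ_m`. -/
theorem expect_norm_add_smul_signSum_pow_le {m : ℕ} (hm : m ≠ 0) {ρ : ℝ}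
    (hρ : ((2 * m - 1 : ℕ) : ℝ) * ρ ^ 2 ≤ 1) {n : ℕ} (x : Fin n → F) (a : F) :
    𝔼 ε, ‖a + ρ • signSum x ε‖ ^ (2 * m) ≤ (𝔼 ε, ‖a + signSum x ε‖ ^ 2) ^ m := by
  induction n generalizing a with
  | zero => simp [signSum, pow_mul]
  | succ n ih =>
    let T := signSum (Fin.tail x)
    have hpeel : ∀ (s : ℤˣ) ε, a + ρ • signSum x (Fin.cons s ε) =
        a + ρ • s • x 0 + ρ • T ε := fun s ε => by rw [signSum_cons, smul_add, add_assoc]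
    have htwo : ∀ ε, ((‖a + ρ • (1 : ℤˣ) • x 0 + T ε‖ ^ 2) ^ m +
        (‖a + ρ • (-1 : ℤˣ) • x 0 + T ε‖ ^ 2) ^ m) / 2 ≤
        ((‖a + signSum x (Fin.cons 1 ε)‖ ^ 2 + ‖a + signSum x (Fin.cons (-1) ε)‖ ^ 2) / 2) ^ m :=
      fun ε => by
        simpa [signSum_cons, pow_mul, T, sub_eq_add_neg, add_comm, add_left_comm,
          add_assoc]
          using hypercontractive_two_point_norm hm hρ (a + T ε) (x 0)
    rw [expect_signs_succ, expect_signs_succ]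
    simp only [hpeel]
    calc _ ≤ ((𝔼 ε, ‖a + ρ • (1 : ℤˣ) • x 0 + T ε‖ ^ 2) ^ m +
          (𝔼 ε, ‖a + ρ • (-1 : ℤˣ) • x 0 + T ε‖ ^ 2) ^ m) / 2 := by
          gcongr <;> exact ih _ _
      _ ≤ (𝔼 ε, (‖a + signSum x (Fin.cons 1 ε)‖ ^ 2 +
          ‖a + signSum x (Fin.cons (-1) ε)‖ ^ 2) / 2) ^ m := by
          simp only [Fintype.expect_eq_sum_div_card, div_pow (Finset.sum _ _)]
          rw [← add_div, div_right_comm]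
          gcongr
          exact half_sum_pow_le hm (fun _ => by positivity) (fun _ => by positivity)
            (fun _ => by positivity) htwo
      _ = _ := by rw [← Finset.expect_div, Finset.expect_add_distrib]

theorem radNorm_two_mul_le {m : ℕ} (hm : m ≠ 0) {n : ℕ} (x : Fin n → F) :
    radNorm (2 * m : ℕ) x ≤ √(2 * m - 1 : ℕ) * radNorm 2 x := by
  have hpos : (0 : ℝ) < (2 * m - 1 : ℕ) := by exact_mod_cast (by omega : 0 < 2 * m - 1)
  have hsq : ((2 * m - 1 : ℕ) : ℝ) * (√(2 * m - 1 : ℕ))⁻¹ ^ 2 ≤ 1 := by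
    rw [inv_pow, Real.sq_sqrt hpos.le, mul_inv_cancel₀ hpos.ne']
  have h := expect_norm_add_smul_signSum_pow_le hm hsq x 0
  simp only [zero_add, norm_smul, mul_pow, ← Finset.mul_expect] at h
  have hnorm2 := radNorm_natCast_pow two_ne_zero x
  push_cast at hnorm2
  rw [← radNorm_natCast_pow (mul_ne_zero two_ne_zero hm), ← hnorm2, ← mul_pow, ← pow_mul,
    Real.norm_of_nonneg (by positivity)] at h
  have := le_of_pow_le_pow_left₀ (mul_ne_zero two_ne_zero hm) (radNorm_nonneg 2 x) h
  rwa [inv_mul_le_iff₀ (Real.sqrt_pos.2 hpos)] at this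

theorem radNorm_two_le_three_mul {n : ℕ} (x : Fin n → F) :
    radNorm 2 x ≤ 3 * radNorm 1 x := by
  set s := radNorm 2 x
  have hs : 0 ≤ s := radNorm_nonneg 2 x
  have hsecond : 𝔼 ε, ‖signSum x ε‖ ^ 2 = s ^ 2 := by
    simpa using (radNorm_natCast_pow two_ne_zero x).symm
  have hfourth : 𝔼 ε, ‖signSum x ε‖ ^ 4 ≤ 9 * s ^ 4 := by
    have h := pow_le_pow_left₀ (radNorm_nonneg _ x) (radNorm_two_mul_le two_ne_zero x) 4
    rw [radNorm_natCast_pow four_ne_zero, mul_pow, pow_mul _ 2 2, Real.sq_sqrt (by positivity)] at h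
    norm_num at h
    exact h
  -- Average `t (t - c)² (t + 2 c) ≥ 0`, i.e. `3 c² t² ≤ 2 c³ t + t⁴`, with `c = 3 s`.
  have havg : 3 * (3 * s) ^ 2 * s ^ 2 ≤
      2 * (3 * s) ^ 3 * radNorm 1 x + 𝔼 ε, ‖signSum x ε‖ ^ 4 := by
    rw [← hsecond, radNorm_one, Finset.mul_expect, Finset.mul_expect, ← Finset.expect_add_distrib]
    refine Finset.expect_le_expect fun ε _ => ?_
    have : 0 ≤ ‖signSum x ε‖ * (‖signSum x ε‖ - 3 * s) ^ 2 * (‖signSum x ε‖ + 2 * (3 * s)) := by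
      positivity
    linarith
  rcases hs.eq_or_lt with hs0 | hs0
  · rw [← hs0]
    exact mul_nonneg (by norm_num) (radNorm_nonneg 1 x)
  · exact le_of_mul_le_mul_left (by linarith) (pow_pos hs0 3)

end Hypercontractivity

section Constants

theorem le_sInf_mul {s : Set ℝ} (hs : s.Nonempty) {a b : ℝ} (hb : 0 ≤ b)
    (h : ∀ K ∈ s, a ≤ K * b) : a ≤ sInf s * b := by
  rcases hb.eq_or_lt with rfl | hb
  · obtain ⟨K, hK⟩ := hs
    simpa using h K hK
  · rw [← div_le_iff₀ hb]
    exact le_csInf hs fun K hK => (div_le_iff₀ hb).2 (h K hK)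

theorem exists_radNorm_le_mul {q p : ℝ} (hq : 0 < q) (hp : 1 ≤ p) :
    ∃ K > 0, ∀ (F : Type u) [NormedAddCommGroup F] [NormedSpace ℝ F] (n : ℕ) (x : Fin n → F),
      radNorm q x ≤ K * radNorm p x := by
  obtain ⟨m, hm⟩ := exists_nat_ge (max q 1)
  have hm0 : m ≠ 0 := by
    rintro rfl
    exact absurd ((le_max_right q 1).trans hm) (by norm_num)
  have hqm : q ≤ (2 * m : ℕ) := by
    push_cast
    linarith [le_max_left q 1]
  have hpos : (0 : ℝ) < (2 * m - 1 : ℕ) := by exact_mod_cast (by omega : 0 < 2 * m - 1)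
  refine ⟨√(2 * m - 1 : ℕ) * 3, by positivity, fun F _ _ n x => ?_⟩
  calc radNorm q x ≤ radNorm (2 * m : ℕ) x := radNorm_mono_exponent hq hqm x
    _ ≤ √(2 * m - 1 : ℕ) * radNorm 2 x := radNorm_two_mul_le hm0 x
    _ ≤ √(2 * m - 1 : ℕ) * (3 * radNorm p x) := by
      gcongr
      exact (radNorm_two_le_three_mul x).trans (by gcongr; exact radNorm_mono_exponent one_pos hp x)
    _ = _ := (mul_assoc _ _ _).symm

theorem exists_isKahaneKhintchineBound {q p : ℝ} (hq : 0 < q) (hp : 1 ≤ p) :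
    ∃ K, IsKahaneKhintchineBound.{u} q p K := by
  obtain ⟨K, hK, hbound⟩ := exists_radNorm_le_mul.{u} hq hp
  refine ⟨K, hK, fun S _ μ _ _ r hr F _ _ _ n x => ?_⟩
  rw [hr.lrNorm_eq_radNorm hq, hr.lrNorm_eq_radNorm (by linarith)]
  exact hbound F n _

theorem radNorm_le_kahaneKhintchineConst_mul {F : Type u} [NormedAddCommGroup F] [NormedSpace ℝ F]
    [CompleteSpace F] {q p : ℝ} (hq : 0 < q) (hp : 1 ≤ p) {n : ℕ} (x : Fin n → F) :
    radNorm q x ≤ kahaneKhintchineConst.{u} q p * radNorm p x := by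
  refine le_sInf_mul (exists_isKahaneKhintchineBound hq hp) (radNorm_nonneg p x) fun K hK => ?_
  obtain ⟨S, _, μ, r, _, _, hr⟩ := exists_isRademacherFamily
  obtain ⟨y, rfl⟩ := exists_nat_extension x
  rw [← hr.lrNorm_eq_radNorm hq, ← hr.lrNorm_eq_radNorm (by linarith)]
  exact hK.2 S μ r hr F n y

theorem one_le_kahaneKhintchineConst {q p : ℝ} (hq : 0 < q) (hp : 1 ≤ p) :
    1 ≤ kahaneKhintchineConst.{u} q p := by
  have h := radNorm_le_kahaneKhintchineConst_mul hq hp fun _ : Fin 1 => ULift.up.{u} (1 : ℝ)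
  have hnorm : ∀ ε, ‖signSum (fun _ : Fin 1 => ULift.up.{u} (1 : ℝ)) ε‖ = 1 := fun ε => by
    rcases Int.units_eq_one_or (ε 0) with hε | hε <;> simp [signSum, hε, ULift.norm_def]
  simpa [radNorm, hnorm] using h

variable {E : Type u} [NormedAddCommGroup E] [NormedSpace ℝ E]

theorem typeConst_nonneg (p : ℝ) : 0 ≤ typeConst E p :=
  Real.sInf_nonneg fun _ h => h.1.le

theorem radNorm_le_typeConst_mul {p : ℝ} (hE : HasRademacherType E p) {n : ℕ} (x : Fin n → E) :
    radNorm p x ≤ typeConst E p * (∑ i, ‖x i‖ ^ p) ^ (1 / p) := by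
  refine le_sInf_mul hE.2 (by positivity) fun K hK => ?_
  obtain ⟨S, _, μ, r, _, _, hr⟩ := exists_isRademacherFamily
  obtain ⟨y, rfl⟩ := exists_nat_extension x
  rw [← hr.lrNorm_eq_radNorm (by linarith [hE.1.1])]
  simpa only [Finset.sum_range] using hK.2 S μ r hr n y

end Constants

section Contraction

open scoped BigOperators BoundedContinuousFunction

variable {T : Type*} [TopologicalSpace T]

theorem le_iSup_boundedContinuousFunction (g : T →ᵇ ℝ) (t : T) : g t ≤ ⨆ t, g t :=
  le_ciSup (f := g) g.isBounded_range.bddAbove t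

theorem iSup_boundedContinuousFunction_le_norm [Nonempty T] (g : T →ᵇ ℝ) : ⨆ t, g t ≤ ‖g‖ :=
  ciSup_le fun t => (le_abs_self _).trans (g.norm_coe_le_norm t)

theorem iSup_add_add_iSup_sub_le [Nonempty T] {g w u v : T →ᵇ ℝ}
    (hw : ∀ t s, 2 * |w t - w s| ≤ |u t - u s| + |v t - v s|) :
    (⨆ t, (g + w) t) + ⨆ t, (g - w) t ≤
      ((⨆ t, (g + u + v) t) + (⨆ t, (g + u - v) t) + (⨆ t, (g - u + v) t) +
        ⨆ t, (g - u - v) t) / 2 := by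
  refine ciSup_add_ciSup_le fun t s => ?_
  have hsup := fun (g : T →ᵇ ℝ) => And.intro (le_iSup_boundedContinuousFunction g t)
    (le_iSup_boundedContinuousFunction g s)
  have hpp := hsup (g + u + v)
  have hpm := hsup (g + u - v)
  have hmp := hsup (g - u + v)
  have hmm := hsup (g - u - v)
  simp only [BoundedContinuousFunction.coe_add, BoundedContinuousFunction.coe_sub,
    Pi.add_apply, Pi.sub_apply] at hpp hpm hmp hmm ⊢
  have hts := hw t s
  have := le_abs_self (w t - w s)
  rcases abs_cases (u t - u s) with ⟨hu, _⟩ | ⟨hu, _⟩ <;>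
    rcases abs_cases (v t - v s) with ⟨hv, _⟩ | ⟨hv, _⟩ <;> rw [hu, hv] at hts <;> linarith

theorem expect_iSup_add_signSum_le [Nonempty T] {n : ℕ} {w u v : Fin n → T →ᵇ ℝ}
    (hw : ∀ j t s, 2 * |w j t - w j s| ≤ |u j t - u j s| + |v j t - v j s|) (h : T →ᵇ ℝ) :
    𝔼 ε, ⨆ t, (h + signSum w ε) t ≤ 𝔼 ε, 𝔼 ε', ⨆ t, (h + signSum u ε + signSum v ε') t := by
  induction n generalizing h with
  | zero => simp [signSum]
  | succ n ih =>
    let U := signSum (Fin.tail u)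
    let V := signSum (Fin.tail v)
    have htail := ih (w := Fin.tail w) fun j => hw j.succ
    have hsplit : ∀ a b a' b' : T →ᵇ ℝ, h + (a + b) + (a' + b') = h + b + b' + a + a' :=
      fun a b a' b' => by abel
    calc 𝔼 ε, ⨆ t, (h + signSum w ε) t
        = ((𝔼 ε, ⨆ t, (h + w 0 + signSum (Fin.tail w) ε) t) +
          𝔼 ε, ⨆ t, (h - w 0 + signSum (Fin.tail w) ε) t) / 2 := by
          simp only [expect_signs_succ, signSum_cons, one_smul, Units.neg_smul, ← add_assoc,
            ← sub_eq_add_neg]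
      _ ≤ ((𝔼 ε, 𝔼 ε', ⨆ t, (h + w 0 + U ε + V ε') t) +
          𝔼 ε, 𝔼 ε', ⨆ t, (h - w 0 + U ε + V ε') t) / 2 :=
          div_le_div_of_nonneg_right (add_le_add (htail _) (htail _)) two_pos.le
      _ = 𝔼 ε, 𝔼 ε', ((⨆ t, (h + U ε + V ε' + w 0) t) + ⨆ t, (h + U ε + V ε' - w 0) t) / 2 := by
          simp only [← Finset.expect_div, Finset.expect_add_distrib, add_right_comm _ (w 0),
            sub_add_eq_add_sub]
      _ ≤ 𝔼 ε, 𝔼 ε', ((⨆ t, (h + U ε + V ε' + u 0 + v 0) t) +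
            (⨆ t, (h + U ε + V ε' + u 0 - v 0) t) + (⨆ t, (h + U ε + V ε' - u 0 + v 0) t) +
            ⨆ t, (h + U ε + V ε' - u 0 - v 0) t) / 2 / 2 :=
          Finset.expect_le_expect fun ε _ => Finset.expect_le_expect fun ε' _ =>
            div_le_div_of_nonneg_right (iSup_add_add_iSup_sub_le (hw 0)) two_pos.le
      _ = _ := by
          simp only [expect_signs_succ, signSum_cons, one_smul, Units.neg_smul, hsplit,
            ← sub_eq_add_neg, ← Finset.expect_div, Finset.expect_add_distrib]
          simp only [U, V]
          ring

theorem radNorm_one_le_of_abs_sub_le {n : ℕ} {w u v : Fin n → T →ᵇ ℝ} {t₀ : T}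
    (hw₀ : ∀ j, w j t₀ = 0) (hw : ∀ j t s, |w j t - w j s| ≤ |u j t - u j s| + |v j t - v j s|) :
    radNorm 1 w ≤ 4 * (radNorm 1 u + radNorm 1 v) := by
  have : Nonempty T := ⟨t₀⟩
  have htwo : ∀ (u : Fin n → T →ᵇ ℝ) ε, ‖signSum ((2 : ℝ) • u) ε‖ = 2 * ‖signSum u ε‖ :=
    fun u ε => by simp [signSum, smul_comm _ (2 : ℝ), ← Finset.smul_sum, norm_smul]
  have hsup : ∀ {w' : Fin n → T →ᵇ ℝ},
      (∀ j t s, |w' j t - w' j s| ≤ |u j t - u j s| + |v j t - v j s|) →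
      𝔼 ε, ⨆ t, signSum w' ε t ≤ 2 * (radNorm 1 u + radNorm 1 v) := fun {w'} hw' => by
    calc 𝔼 ε, ⨆ t, signSum w' ε t
        ≤ 𝔼 ε, 𝔼 ε', ⨆ t, (signSum ((2 : ℝ) • u) ε + signSum ((2 : ℝ) • v) ε') t := by
          simpa only [zero_add] using expect_iSup_add_signSum_le (fun j t s => by
            simpa [← mul_sub, ← mul_add, abs_mul] using hw' j t s) 0
      _ ≤ 𝔼 ε, 𝔼 ε', (2 * ‖signSum u ε‖ + 2 * ‖signSum v ε'‖) :=
          Finset.expect_le_expect fun ε _ => Finset.expect_le_expect fun ε' _ =>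
            (iSup_boundedContinuousFunction_le_norm _).trans <|
              (norm_add_le _ _).trans_eq (by rw [htwo, htwo])
      _ = _ := by
          simp [radNorm_one, Finset.expect_add_distrib, ← Finset.mul_expect, mul_add]
  have hneg : ∀ ε t, signSum (-w) ε t = -signSum w ε t := fun ε t => by simp [signSum]
  calc radNorm 1 w = 𝔼 ε, ‖signSum w ε‖ := radNorm_one w
    _ ≤ 𝔼 ε, ((⨆ t, signSum w ε t) + ⨆ t, signSum (-w) ε t) := by
        refine Finset.expect_le_expect fun ε _ => ?_
        have hzero : signSum w ε t₀ = 0 := by simp [signSum, Units.smul_def, hw₀]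
        have hpos := le_iSup_boundedContinuousFunction (signSum w ε)
        have hneg' := le_iSup_boundedContinuousFunction (signSum (-w) ε)
        refine (BoundedContinuousFunction.norm_le ?_).2 fun t => abs_le.2 ⟨?_, ?_⟩
        · linarith [hpos t₀, hneg' t₀, hneg ε t₀]
        · linarith [hpos t₀, hneg' t, hneg ε t]
        · linarith [hneg' t₀, hneg ε t₀, hpos t]
    _ ≤ 2 * (radNorm 1 u + radNorm 1 v) + 2 * (radNorm 1 u + radNorm 1 v) := by
        rw [Finset.expect_add_distrib]
        refine add_le_add (hsup hw) (hsup fun j t s => ?_)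
        simpa [abs_sub_comm, neg_add_eq_sub] using hw j t s
    _ = _ := by ring

end Contraction

theorem abs_add_pow_sub_pow_le (m : ℕ) {s t δ η : ℝ} (hs : |s| ≤ δ) (ht : |t| ≤ η) :
    |(t + s) ^ m - t ^ m| ≤ (δ + η) ^ m - η ^ m := by
  have hδ := (abs_nonneg s).trans hs
  have hη := (abs_nonneg t).trans ht
  induction m with
  | zero => simp
  | succ m ih =>
    calc |(t + s) ^ (m + 1) - t ^ (m + 1)| = |(t + s) * ((t + s) ^ m - t ^ m) + s * t ^ m| := by
          congr 1; ring
      _ ≤ |t + s| * |(t + s) ^ m - t ^ m| + |s| * |t| ^ m := by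
          rw [← abs_pow, ← abs_mul, ← abs_mul]
          exact abs_add_le _ _
      _ ≤ (δ + η) * ((δ + η) ^ m - η ^ m) + δ * η ^ m := by
          gcongr
          exact (abs_add_le _ _).trans (by linarith)
      _ = _ := by ring

theorem abs_add_pow_sub_pow_sub_le (k : ℕ) {s s' t t' δ η : ℝ} (hs : |s| ≤ δ) (hs' : |s'| ≤ δ)
    (ht : |t| ≤ η) (ht' : |t'| ≤ η) :
    |((t + s) ^ k - t ^ k) - ((t' + s') ^ k - t' ^ k)| ≤
      k * (δ + η) ^ (k - 1) * |s - s'| + k * ((δ + η) ^ (k - 1) - η ^ (k - 1)) * |t - t'| := by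
  have hincrement : |(t + s) ^ k - (t + s') ^ k| ≤ k * (δ + η) ^ (k - 1) * |s - s'| := by
    have hmax : max |t + s| |t + s'| ≤ δ + η :=
      max_le ((abs_add_le _ _).trans (by linarith)) ((abs_add_le _ _).trans (by linarith))
    calc _ ≤ |t + s - (t + s')| * k * max |t + s| |t + s'| ^ (k - 1) := abs_pow_sub_pow_le _ _ _
      _ ≤ |t + s - (t + s')| * k * (δ + η) ^ (k - 1) := by gcongr
      _ = _ := by rw [add_sub_add_left_eq_sub]; ring
  have hbase : ‖((t + s') ^ k - t ^ k) - ((t' + s') ^ k - t' ^ k)‖ ≤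
      k * ((δ + η) ^ (k - 1) - η ^ (k - 1)) * ‖t - t'‖ := by
    refine (convex_Icc (-η) η).norm_image_sub_le_of_norm_hasDerivWithin_le
      (f := fun t => (t + s') ^ k - t ^ k)
      (f' := fun t => k * (t + s') ^ (k - 1) * 1 - k * t ^ (k - 1) * 1)
      (fun r _ => ?_) (fun r hr => ?_) (abs_le.1 ht') (abs_le.1 ht)
    · exact ((((hasDerivAt_id r).add_const s').pow k).sub
        ((hasDerivAt_id r).pow k)).hasDerivWithinAt
    · rw [mul_one, mul_one, ← mul_sub, norm_mul, Real.norm_natCast]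
      exact mul_le_mul_of_nonneg_left (abs_add_pow_sub_pow_le (k - 1) hs' (abs_le.2 hr))
        (Nat.cast_nonneg k)
  calc _ = |((t + s) ^ k - (t + s') ^ k) +
        (((t + s') ^ k - t ^ k) - ((t' + s') ^ k - t' ^ k))| := by congr 1; ring
    _ ≤ _ := (abs_add_le _ _).trans (add_le_add hincrement hbase)

section TensorPower

open scoped BigOperators BoundedContinuousFunction

variable {E : Type u} [NormedAddCommGroup E] [NormedSpace ℝ E]

/-- The canonical embedding of `E` into the bounded continuous functions on the closed unit ball of
its dual, `x ↦ (f ↦ f x)`. -/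
noncomputable def dualBallEval :
    E →ₗ[ℝ] Metric.closedBall (0 : StrongDual ℝ E) 1 →ᵇ ℝ where
  toFun x := .ofNormedAddCommGroup (fun f => (f : StrongDual ℝ E) x) (by fun_prop) ‖x‖ fun f => by
    simpa using (f : StrongDual ℝ E).le_of_opNorm_le (mem_closedBall_zero_iff.1 f.2) x
  map_add' x y := by ext; simp
  map_smul' c x := by ext; simp

@[simp]
theorem dualBallEval_apply (x : E) (f : Metric.closedBall (0 : StrongDual ℝ E) 1) :
    dualBallEval x f = (f : StrongDual ℝ E) x := rfl

theorem norm_dualBallEval_le (x : E) : ‖dualBallEval x‖ ≤ ‖x‖ :=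
  (BoundedContinuousFunction.norm_le (norm_nonneg x)).2 fun f => by
    simpa using (f : StrongDual ℝ E).le_of_opNorm_le (mem_closedBall_zero_iff.1 f.2) x

theorem abs_dualBallEval_apply_le (x : E) (f : Metric.closedBall (0 : StrongDual ℝ E) 1) :
    |dualBallEval x f| ≤ ‖x‖ :=
  ((dualBallEval x).norm_coe_le_norm f).trans (norm_dualBallEval_le x)

theorem norm_signSum_tensorPow_sub (k : ℕ) {n : ℕ} (x y : Fin n → E) (ε : Fin n → ℤˣ) :
    ‖signSum (fun j => tensorPow k (x j) - tensorPow k (y j)) ε‖ =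
      ‖signSum (fun j => dualBallEval (x j) ^ k - dualBallEval (y j) ^ k) ε‖ := by
  have hcoe : signSum (fun j => tensorPow k (x j) - tensorPow k (y j)) ε =
      UniformSpace.Completion.toComplₗᵢ (𝕜 := ℝ)
        (signSum (fun j => SymTensor.pow k (x j) - SymTensor.pow k (y j)) ε) := by
    rw [map_signSum]
    simp only [map_sub]
    rfl
  have hpow : ∀ (f : StrongDual ℝ E) (z : E),
      SymTensor.dualPow k f (SymTensor.incl E k (SymTensor.pow k z)) = f z ^ k := fun f z =>
    (SymTensor.dualPow_tprod k f fun _ => z).trans (by simp)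
  rw [hcoe, LinearIsometry.norm_map, SymTensor.norm_def,
    BoundedContinuousFunction.norm_eq_iSup_norm]
  simp [signSum, Units.smul_def, hpow]

theorem norm_tensorPow_sub (k : ℕ) (x y : E) :
    ‖tensorPow k x - tensorPow k y‖ = ‖dualBallEval x ^ k - dualBallEval y ^ k‖ := by
  simpa [signSum] using norm_signSum_tensorPow_sub k ![x] ![y] 1

theorem norm_tensorPow_sub_le (k : ℕ) (x y : E) :
    ‖tensorPow k x - tensorPow k y‖ ≤ (‖x - y‖ + ‖y‖) ^ k - ‖y‖ ^ k := by
  rw [norm_tensorPow_sub]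
  refine (BoundedContinuousFunction.norm_le (sub_nonneg.2 (by gcongr; simp))).2 fun f => ?_
  simpa using abs_add_pow_sub_pow_le k (abs_dualBallEval_apply_le (x - y) f)
    (abs_dualBallEval_apply_le y f)

theorem tensorPow_zero {k : ℕ} (hk : k ≠ 0) : tensorPow k (0 : E) = 0 := by
  have hpow : SymTensor.pow k (0 : E) = 0 := by
    have : NeZero k := ⟨hk⟩
    exact Subtype.ext ((PiTensorProduct.tprod ℝ).map_coord_zero (0 : Fin k) rfl)
  rw [tensorPow, hpow, UniformSpace.Completion.coe_zero]

theorem norm_tensorPow_le {k : ℕ} (hk : k ≠ 0) (x : E) : ‖tensorPow k x‖ ≤ ‖x‖ ^ k := by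
  simpa [tensorPow_zero hk, hk] using norm_tensorPow_sub_le k x 0

theorem continuous_tensorPow (k : ℕ) : Continuous (tensorPow k : E → SymInjTensor E k) := by
  refine continuous_iff_continuousAt.2 fun y => tendsto_iff_norm_sub_tendsto_zero.2 ?_
  refine squeeze_zero (fun _ => norm_nonneg _) (fun x => norm_tensorPow_sub_le k x y) ?_
  have : Continuous fun x : E => (‖x - y‖ + ‖y‖) ^ k - ‖y‖ ^ k := by fun_prop
  simpa using this.tendsto y

/-- The weight `k ((δ + η)ᵏ - ηᵏ)`, which for `δ = ‖x - y‖` and `η = ‖y‖` plays the role of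
`‖⊗ᵏx - ⊗ᵏy‖` in the type inequality for differences of tensor powers. -/
def diffWeight (k : ℕ) (δ η : ℝ) : ℝ := k * ((δ + η) ^ k - η ^ k)

theorem diffWeight_nonneg (k : ℕ) {δ η : ℝ} (hδ : 0 ≤ δ) (hη : 0 ≤ η) : 0 ≤ diffWeight k δ η :=
  mul_nonneg (Nat.cast_nonneg k) (sub_nonneg.2 (pow_le_pow_left₀ hη (by linarith) _))

theorem diffWeight_eq_sum (k : ℕ) (δ η : ℝ) : diffWeight k δ η =
    k * ∑ i ∈ Finset.range k, (k.choose (i + 1) : ℝ) * (δ ^ (i + 1) * η ^ (k - 1 - i)) := by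
  rw [diffWeight, add_pow, Finset.sum_range_succ']
  congr 1
  simp only [pow_zero, Nat.sub_zero, Nat.choose_zero_right, Nat.cast_one, mul_one, one_mul,
    add_sub_cancel_right]
  refine Finset.sum_congr rfl fun i _ => ?_
  rw [Nat.sub_sub, add_comm 1 i]
  ring

theorem radNorm_one_tensorPow_sub_le (k : ℕ) {n : ℕ} (x y : Fin n → E) :
    radNorm 1 (fun j => tensorPow k (x j) - tensorPow k (y j)) ≤
      4 * (radNorm 1 (fun j => (k * (‖x j - y j‖ + ‖y j‖) ^ (k - 1)) • (x j - y j)) +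
        radNorm 1 fun j =>
          (k * ((‖x j - y j‖ + ‖y j‖) ^ (k - 1) - ‖y j‖ ^ (k - 1))) • y j) := by
  have heval : ∀ z : Fin n → E, radNorm 1 (fun j => dualBallEval (z j)) ≤ radNorm 1 z := fun z => by
    rw [radNorm_one, radNorm_one]
    exact Finset.expect_le_expect fun ε _ =>
      (congrArg norm (map_signSum (dualBallEval (E := E)).toAddMonoidHom z ε)).symm.trans_le
        (norm_dualBallEval_le _)
  have hcontract := radNorm_one_le_of_abs_sub_le
    (w := fun j => dualBallEval (x j) ^ k - dualBallEval (y j) ^ k)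
    (u := fun j => dualBallEval ((k * (‖x j - y j‖ + ‖y j‖) ^ (k - 1)) • (x j - y j)))
    (v := fun j => dualBallEval ((k * ((‖x j - y j‖ + ‖y j‖) ^ (k - 1) - ‖y j‖ ^ (k - 1))) • y j))
    (t₀ := ⟨0, Metric.mem_closedBall_self zero_le_one⟩) (fun j => by simp) fun j f g => by
      have hpow := abs_add_pow_sub_pow_sub_le k (abs_dualBallEval_apply_le (x j - y j) f)
        (abs_dualBallEval_apply_le (x j - y j) g) (abs_dualBallEval_apply_le (y j) f)
        (abs_dualBallEval_apply_le (y j) g)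
      have hmono : ‖y j‖ ^ (k - 1) ≤ (‖x j - y j‖ + ‖y j‖) ^ (k - 1) := by gcongr; simp
      have hnonneg : 0 ≤ k * ((‖x j - y j‖ + ‖y j‖) ^ (k - 1) - ‖y j‖ ^ (k - 1)) :=
        mul_nonneg k.cast_nonneg (sub_nonneg.2 hmono)
      simp only [map_smul, BoundedContinuousFunction.coe_smul, smul_eq_mul, ← mul_sub, abs_mul,
        abs_of_nonneg hnonneg, abs_of_nonneg (show 0 ≤ k * (‖x j - y j‖ + ‖y j‖) ^ (k - 1) by
          positivity)]
      simpa using hpow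
  calc _ = radNorm 1 fun j => dualBallEval (x j) ^ k - dualBallEval (y j) ^ k := by
        simp only [radNorm_one, norm_signSum_tensorPow_sub]
    _ ≤ _ := hcontract.trans (by gcongr ?_ * (?_ + ?_) <;> exact heval _)

theorem radNorm_one_le_typeConst_mul {p : ℝ} (hE : HasRademacherType E p) {n : ℕ}
    (x : Fin n → E) : radNorm 1 x ≤ typeConst E p * (∑ i, ‖x i‖ ^ p) ^ (1 / p) :=
  (radNorm_mono_exponent one_pos hE.1.1 x).trans (radNorm_le_typeConst_mul hE x)

theorem radNorm_one_tensorPow_sub_le_diffWeight {p : ℝ} (hE : HasRademacherType E p) {k : ℕ}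
    (hk : k ≠ 0) {n : ℕ} (x y : Fin n → E) :
    radNorm 1 (fun j => tensorPow k (x j) - tensorPow k (y j)) ≤
      8 * (typeConst E p * (∑ j, diffWeight k ‖x j - y j‖ ‖y j‖ ^ p) ^ (1 / p)) := by
  have hp : 0 < p := one_pos.trans_le hE.1.1
  have htype : ∀ z : Fin n → E, (∀ j, ‖z j‖ ≤ diffWeight k ‖x j - y j‖ ‖y j‖) →
      radNorm 1 z ≤ typeConst E p * (∑ j, diffWeight k ‖x j - y j‖ ‖y j‖ ^ p) ^ (1 / p) :=
    fun z hz => (radNorm_one_le_typeConst_mul hE z).trans <|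
      mul_le_mul_of_nonneg_left (by gcongr with j; exact hz j) (typeConst_nonneg p)
  have hmono : ∀ j, ‖y j‖ ^ (k - 1) ≤ (‖x j - y j‖ + ‖y j‖) ^ (k - 1) := fun j => by
    gcongr; simp
  have hsplit : ∀ j, k * (‖x j - y j‖ + ‖y j‖) ^ (k - 1) * ‖x j - y j‖ +
      k * ((‖x j - y j‖ + ‖y j‖) ^ (k - 1) - ‖y j‖ ^ (k - 1)) * ‖y j‖ =
      diffWeight k ‖x j - y j‖ ‖y j‖ := fun j => by
    rw [diffWeight, ← mul_pow_sub_one hk (‖x j - y j‖ + ‖y j‖), ← mul_pow_sub_one hk ‖y j‖]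
    ring
  have hcoeff : ∀ j, 0 ≤ k * ((‖x j - y j‖ + ‖y j‖) ^ (k - 1) - ‖y j‖ ^ (k - 1)) := fun j =>
    mul_nonneg k.cast_nonneg (sub_nonneg.2 (hmono j))
  have hdiff := htype (fun j => (k * (‖x j - y j‖ + ‖y j‖) ^ (k - 1)) • (x j - y j)) fun j => by
    rw [norm_smul, Real.norm_of_nonneg (by positivity), ← hsplit]
    exact le_add_of_nonneg_right (mul_nonneg (hcoeff j) (norm_nonneg _))
  have hbase := htype (fun j =>
      (k * ((‖x j - y j‖ + ‖y j‖) ^ (k - 1) - ‖y j‖ ^ (k - 1))) • y j) fun j => by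
    rw [norm_smul, Real.norm_of_nonneg (hcoeff j), ← hsplit]
    exact le_add_of_nonneg_left (by positivity)
  linarith [radNorm_one_tensorPow_sub_le k x y]

theorem radNorm_tensorPow_sub_le_diffWeight {p q : ℝ} (hE : HasRademacherType E p) (hq : 0 < q)
    {k : ℕ} (hk : k ≠ 0) {n : ℕ} (x y : Fin n → E) :
    radNorm q (fun j => tensorPow k (x j) - tensorPow k (y j)) ≤
      24 * kahaneKhintchineConst.{u} q 2 * typeConst E p *
        (∑ j, diffWeight k ‖x j - y j‖ ‖y j‖ ^ p) ^ (1 / p) := by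
  have hK : 0 ≤ kahaneKhintchineConst.{u} q 2 :=
    zero_le_one.trans (one_le_kahaneKhintchineConst hq one_le_two)
  calc _ ≤ kahaneKhintchineConst.{u} q 2 *
        radNorm 2 fun j => tensorPow k (x j) - tensorPow k (y j) :=
        radNorm_le_kahaneKhintchineConst_mul hq one_le_two _
    _ ≤ kahaneKhintchineConst.{u} q 2 * (3 * (8 * (typeConst E p *
        (∑ j, diffWeight k ‖x j - y j‖ ‖y j‖ ^ p) ^ (1 / p)))) := by
        gcongr
        exact (radNorm_two_le_three_mul _).trans
          (by gcongr; exact radNorm_one_tensorPow_sub_le_diffWeight hE hk x y)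
    _ = _ := by ring

end TensorPower

section Symmetrization

open scoped BigOperators

variable {Ω F : Type*} [MeasurableSpace Ω] {P : Measure Ω} [NormedAddCommGroup F]

theorem eLpNorm_ofReal_rpow {q : ℝ} (hq : 0 < q) (f : Ω → F) :
    eLpNorm f (ENNReal.ofReal q) P ^ q = ∫⁻ ω, ‖f ω‖ₑ ^ q ∂P := by
  rw [eLpNorm_eq_lintegral_rpow_enorm_toReal (by simpa using hq) ENNReal.ofReal_ne_top,
    ENNReal.toReal_ofReal hq.le, ← ENNReal.rpow_mul, one_div_mul_cancel hq.ne', ENNReal.rpow_one]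

theorem enorm_integral_rpow_le [IsProbabilityMeasure P] [NormedSpace ℝ F] {f : Ω → F}
    (hf : AEStronglyMeasurable f P) {q : ℝ} (hq : 1 ≤ q) :
    ‖∫ ω, f ω ∂P‖ₑ ^ q ≤ ∫⁻ ω, ‖f ω‖ₑ ^ q ∂P := by
  have hq0 : 0 < q := one_pos.trans_le hq
  rw [← eLpNorm_ofReal_rpow hq0]
  gcongr
  calc ‖∫ ω, f ω ∂P‖ₑ ≤ eLpNorm f 1 P :=
        (enorm_integral_le_lintegral_enorm f).trans_eq eLpNorm_one_eq_lintegral_enorm.symm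
    _ ≤ eLpNorm f (ENNReal.ofReal q) P :=
        eLpNorm_le_eLpNorm_of_exponent_le (ENNReal.one_le_ofReal.2 hq) hf

theorem eLpNorm_sub_integral_le [IsProbabilityMeasure P] [NormedSpace ℝ F] [CompleteSpace F]
    {f : Ω → F} (hf : Integrable f P) {q : ℝ} (hq : 1 ≤ q) :
    eLpNorm (fun ω => f ω - ∫ ω', f ω' ∂P) (ENNReal.ofReal q) P ≤
      eLpNorm (fun z : Ω × Ω => f z.1 - f z.2) (ENNReal.ofReal q) (P.prod P) := by
  have hq0 : 0 < q := one_pos.trans_le hq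
  have hdiff : AEStronglyMeasurable (fun z : Ω × Ω => f z.1 - f z.2) (P.prod P) :=
    hf.aestronglyMeasurable.comp_fst.sub hf.aestronglyMeasurable.comp_snd
  rw [← ENNReal.rpow_le_rpow_iff hq0, eLpNorm_ofReal_rpow hq0, eLpNorm_ofReal_rpow hq0,
    lintegral_prod _ (hdiff.enorm.pow_const q)]
  refine lintegral_mono fun ω => ?_
  have hmean : f ω - ∫ ω', f ω' ∂P = ∫ ω', (f ω - f ω') ∂P := by
    rw [integral_sub (integrable_const _) hf]
    simp
  rw [hmean]
  exact enorm_integral_rpow_le (aestronglyMeasurable_const.sub hf.aestronglyMeasurable) hq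

theorem aestronglyMeasurable_signSum_pi {n : ℕ} [SigmaFinite P] {f : Ω → F}
    (hf : AEStronglyMeasurable f P) (ε : Fin n → ℤˣ) :
    AEStronglyMeasurable (fun w : Fin n → Ω => signSum (fun j => f (w j)) ε)
      (Measure.pi fun _ => P) := by
  refine Finset.aestronglyMeasurable_fun_sum _ fun j _ => AEStronglyMeasurable.const_smul ?_ _
  exact hf.comp_quasiMeasurePreserving
    (Measure.quasiMeasurePreserving_eval (μ := fun _ : Fin n => P) j)

theorem eLpNorm_signSum_pi_of_odd {n : ℕ} [SigmaFinite P] {f : Ω → F}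
    (hf : AEStronglyMeasurable f P) {σ : Ω → Ω} (hσ : MeasurePreserving σ P P)
    (hodd : ∀ ω, f (σ ω) = -f ω) (q : ℝ≥0∞) (ε : Fin n → ℤˣ) :
    eLpNorm (fun w : Fin n → Ω => signSum (fun j => f (w j)) ε) q (Measure.pi fun _ => P) =
      eLpNorm (fun w : Fin n → Ω => ∑ j, f (w j)) q (Measure.pi fun _ => P) := by
  let τ : ℤˣ → Ω → Ω := fun s => if s = 1 then id else σ
  have hτ : ∀ s, MeasurePreserving (τ s) P P := fun s => by
    by_cases h : s = 1
    · simpa [τ, h] using MeasurePreserving.id P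
    · simpa [τ, h] using hσ
  have hτf : ∀ s ω, f (τ s ω) = s • f ω := fun s ω => by
    rcases Int.units_eq_one_or s with rfl | rfl
    · simp [τ]
    · simp [τ, hodd, show (-1 : ℤˣ) ≠ 1 by decide]
  have hsum : AEStronglyMeasurable (fun w : Fin n → Ω => ∑ j, f (w j))
      (Measure.pi fun _ => P) := by
    simpa [signSum] using aestronglyMeasurable_signSum_pi hf (1 : Fin n → ℤˣ)
  rw [← eLpNorm_comp_measurePreserving hsum
    (measurePreserving_pi (fun _ => P) (fun _ => P) fun j => hτ (ε j))]
  simp only [Function.comp_def, hτf, signSum]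

theorem eLpNorm_sum_sub_pi_prod_le [IsProbabilityMeasure P] {f : Ω → F}
    (hf : AEStronglyMeasurable f P) {q : ℝ≥0∞} (hq : 1 ≤ q) {n : ℕ} (ε : Fin n → ℤˣ) :
    eLpNorm (fun z : Fin n → Ω × Ω => ∑ j, (f (z j).1 - f (z j).2)) q
        (Measure.pi fun _ => P.prod P) ≤
      2 * eLpNorm (fun w : Fin n → Ω => signSum (fun j => f (w j)) ε) q
        (Measure.pi fun _ => P) := by
  have hfst : MeasurePreserving (fun (z : Fin n → Ω × Ω) j => (z j).1)
      (Measure.pi fun _ => P.prod P) (Measure.pi fun _ => P) :=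
    measurePreserving_pi (fun _ => P.prod P) (fun _ => P) fun _ => measurePreserving_fst
  have hsnd : MeasurePreserving (fun (z : Fin n → Ω × Ω) j => (z j).2)
      (Measure.pi fun _ => P.prod P) (Measure.pi fun _ => P) :=
    measurePreserving_pi (fun _ => P.prod P) (fun _ => P) fun _ => measurePreserving_snd
  have hsign := aestronglyMeasurable_signSum_pi (n := n) hf ε
  have hswap := eLpNorm_signSum_pi_of_odd (f := fun z : Ω × Ω => f z.1 - f z.2)
    (hf.comp_fst.sub hf.comp_snd) Measure.measurePreserving_swap (fun z => by simp) q ε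
  have htriangle := eLpNorm_sub_le (hsign.comp_measurePreserving hfst)
    (hsign.comp_measurePreserving hsnd) hq
  rw [eLpNorm_comp_measurePreserving hsign hfst, eLpNorm_comp_measurePreserving hsign hsnd,
    ← two_mul] at htriangle
  refine hswap.symm.trans_le (le_of_eq_of_le ?_ htriangle)
  congr 1
  ext z
  simp [signSum, smul_sub]

theorem eLpNorm_sum_sub_integral_le_signSum [IsProbabilityMeasure P] [NormedSpace ℝ F]
    [CompleteSpace F] {f : Ω → F} (hf : Integrable f P) {q : ℝ} (hq : 1 ≤ q) {n : ℕ}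
    (ε : Fin n → ℤˣ) :
    eLpNorm (fun w : Fin n → Ω => ∑ j, (f (w j) - ∫ ω, f ω ∂P)) (ENNReal.ofReal q)
        (Measure.pi fun _ => P) ≤
      2 * eLpNorm (fun w : Fin n → Ω => signSum (fun j => f (w j)) ε) (ENNReal.ofReal q)
        (Measure.pi fun _ => P) := by
  have hfj : ∀ j : Fin n, Integrable (fun w : Fin n → Ω => f (w j)) (Measure.pi fun _ => P) :=
    fun j => (measurePreserving_eval (fun _ : Fin n => P) j).integrable_comp_of_integrable hf
  have hS : Integrable (fun w : Fin n → Ω => ∑ j, f (w j)) (Measure.pi fun _ => P) :=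
    integrable_finsetSum _ fun j _ => hfj j
  have hmean : ∫ w : Fin n → Ω, ∑ j, f (w j) ∂(Measure.pi fun _ => P) =
      ∑ _j : Fin n, ∫ ω, f ω ∂P := by
    rw [integral_finsetSum _ fun j _ => hfj j]
    exact Finset.sum_congr rfl fun j _ => integral_comp_eval hf.aestronglyMeasurable
  have hcentered := eLpNorm_sub_integral_le hS hq
  have hpairs := eLpNorm_comp_measurePreserving (p := ENNReal.ofReal q)
    (g := fun z : (Fin n → Ω) × (Fin n → Ω) => ∑ j, f (z.1 j) - ∑ j, f (z.2 j))
    (hS.aestronglyMeasurable.comp_fst.sub hS.aestronglyMeasurable.comp_snd)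
    (measurePreserving_arrowProdEquivProdArrow Ω Ω (Fin n) (fun _ => P) fun _ => P)
  have hsymm := eLpNorm_sum_sub_pi_prod_le hf.aestronglyMeasurable (ENNReal.one_le_ofReal.2 hq) ε
  simp only [Finset.sum_sub_distrib] at hsymm ⊢
  exact (hmean ▸ hcentered).trans (hpairs.symm.trans_le hsymm)

theorem sum_enorm_signSum_rpow {q : ℝ} (hq : 0 < q) {n : ℕ} (x : Fin n → F) :
    ∑ ε, ‖signSum x ε‖ₑ ^ q = 2 ^ n * ‖radNorm q x‖ₑ ^ q := by
  have hcard : (Fintype.card (Fin n → ℤˣ) : ℝ) = 2 ^ n := by simp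
  have henorm : ∀ ε, ‖signSum x ε‖ₑ ^ q = ENNReal.ofReal (‖signSum x ε‖ ^ q) := fun ε => by
    rw [← ofReal_norm, ENNReal.ofReal_rpow_of_nonneg (norm_nonneg _) hq.le]
  have hradNorm : radNorm q x ^ q = 𝔼 ε, ‖signSum x ε‖ ^ q :=
    Real.rpow_inv_rpow (Finset.expect_nonneg fun _ _ => by positivity) hq.ne'
  rw [Real.enorm_of_nonneg (radNorm_nonneg q x),
    ENNReal.ofReal_rpow_of_nonneg (radNorm_nonneg q x) hq.le, hradNorm,
    Fintype.expect_eq_sum_div_card, hcard, Finset.sum_congr rfl fun ε _ => henorm ε,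
    ← ENNReal.ofReal_sum_of_nonneg fun ε _ => by positivity,
    ENNReal.ofReal_div_of_pos (by positivity), ENNReal.ofReal_pow zero_le_two,
    ENNReal.ofReal_ofNat, ENNReal.mul_div_cancel (by simp) (by simp)]

theorem eLpNorm_sum_sub_integral_le_radNorm [IsProbabilityMeasure P] [NormedSpace ℝ F]
    [CompleteSpace F] {f : Ω → F} (hf : Integrable f P) {q : ℝ} (hq : 1 ≤ q) (n : ℕ) :
    eLpNorm (fun w : Fin n → Ω => ∑ j, (f (w j) - ∫ ω, f ω ∂P)) (ENNReal.ofReal q)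
        (Measure.pi fun _ => P) ≤
      2 * eLpNorm (fun w : Fin n → Ω => radNorm q fun j => f (w j)) (ENNReal.ofReal q)
        (Measure.pi fun _ => P) := by
  have hq0 : 0 < q := one_pos.trans_le hq
  set I := eLpNorm (fun w : Fin n → Ω => ∑ j, (f (w j) - ∫ ω, f ω ∂P)) (ENNReal.ofReal q)
    (Measure.pi fun _ => P)
  have hsign : ∀ ε : Fin n → ℤˣ, I ^ q ≤
      2 ^ q * ∫⁻ w : Fin n → Ω, ‖signSum (fun j => f (w j)) ε‖ₑ ^ q ∂(Measure.pi fun _ => P) :=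
    fun ε => by
      rw [← eLpNorm_ofReal_rpow hq0, ← ENNReal.mul_rpow_of_nonneg _ _ hq0.le]
      gcongr
      exact eLpNorm_sum_sub_integral_le_signSum hf hq ε
  rw [← ENNReal.rpow_le_rpow_iff hq0, ENNReal.mul_rpow_of_nonneg _ _ hq0.le,
    ← ENNReal.mul_le_mul_iff_right (a := 2 ^ n) (by simp) (by simp)]
  calc 2 ^ n * I ^ q = ∑ _ε : Fin n → ℤˣ, I ^ q := by simp
    _ ≤ ∑ ε : Fin n → ℤˣ, 2 ^ q *
        ∫⁻ w : Fin n → Ω, ‖signSum (fun j => f (w j)) ε‖ₑ ^ q ∂(Measure.pi fun _ => P) :=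
        Finset.sum_le_sum fun ε _ => hsign ε
    _ = 2 ^ q * ∫⁻ w : Fin n → Ω, 2 ^ n * ‖radNorm q fun j => f (w j)‖ₑ ^ q
        ∂(Measure.pi fun _ => P) := by
        simp only [← sum_enorm_signSum_rpow hq0]
        rw [lintegral_finsetSum' _ fun ε _ =>
          (aestronglyMeasurable_signSum_pi hf.aestronglyMeasurable ε).enorm.pow_const q,
          Finset.mul_sum]
    _ = _ := by
        rw [lintegral_const_mul' _ _ (by simp), mul_left_comm, eLpNorm_ofReal_rpow hq0]

theorem eLpNorm_sum_rpow_pi_le [IsProbabilityMeasure P] {f : Ω → F}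
    (hf : AEStronglyMeasurable f P) {p q : ℝ} (hp : 0 < p) (hpq : p ≤ q) (n : ℕ) :
    eLpNorm (fun w : Fin n → Ω => (∑ j, ‖f (w j)‖ ^ p) ^ (1 / p)) (ENNReal.ofReal q)
        (Measure.pi fun _ => P) ≤
      (n : ℝ≥0∞) ^ (1 / p) * eLpNorm f (ENNReal.ofReal q) P := by
  have hr : 1 ≤ q / p := (one_le_div hp).2 hpq
  have hsum : ∀ w : Fin n → Ω, (∑ j, ‖f (w j)‖ ^ p) ^ (1 / p) =
      ‖∑ j, ‖f (w j)‖ ^ p‖ ^ (1 / p) := fun w => by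
    rw [Real.norm_of_nonneg (Finset.sum_nonneg fun j _ => by positivity)]
  have hexp : ENNReal.ofReal q * ENNReal.ofReal (1 / p) = ENNReal.ofReal (q / p) := by
    rw [← ENNReal.ofReal_mul (hp.le.trans hpq), mul_one_div]
  have hexp' : ENNReal.ofReal (q / p) * ENNReal.ofReal p = ENNReal.ofReal q := by
    rw [← ENNReal.ofReal_mul (zero_le_one.trans hr), div_mul_cancel₀ q hp.ne']
  have hfp : AEStronglyMeasurable (fun ω => ‖f ω‖ ^ p) P :=
    (hf.norm.aemeasurable.pow_const p).aestronglyMeasurable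
  have heval := fun j => measurePreserving_eval (fun _ : Fin n => P) j
  have hterm : ∀ j, eLpNorm (fun w : Fin n → Ω => ‖f (w j)‖ ^ p) (ENNReal.ofReal (q / p))
      (Measure.pi fun _ => P) = eLpNorm f (ENNReal.ofReal q) P ^ p := fun j => by
    rw [← hexp', ← eLpNorm_norm_rpow f hp]
    exact eLpNorm_comp_measurePreserving (g := fun ω => ‖f ω‖ ^ p) hfp (heval j)
  have hminkowski : eLpNorm (fun w : Fin n → Ω => ∑ j, ‖f (w j)‖ ^ p) (ENNReal.ofReal (q / p))
      (Measure.pi fun _ => P) ≤ n * eLpNorm f (ENNReal.ofReal q) P ^ p := by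
    have h := eLpNorm_sum_le (s := Finset.univ) (f := fun j (w : Fin n → Ω) => ‖f (w j)‖ ^ p)
      (fun j _ => hfp.comp_measurePreserving (heval j)) (ENNReal.one_le_ofReal.2 hr)
    simpa [hterm, Finset.sum_fn] using h
  simp only [hsum]
  rw [eLpNorm_norm_rpow _ (by positivity), hexp]
  calc _ ≤ (n * eLpNorm f (ENNReal.ofReal q) P ^ p) ^ (1 / p) := by gcongr
    _ = _ := by
        rw [ENNReal.mul_rpow_of_nonneg _ _ (by positivity), ← ENNReal.rpow_mul,
          mul_one_div_cancel hp.ne', ENNReal.rpow_one]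

theorem eLpNorm_sum_sub_integral_le_of_radNorm_le [IsProbabilityMeasure P] [NormedSpace ℝ F]
    [CompleteSpace F] {f : Ω → F} (hf : Integrable f P) {W : Ω → ℝ}
    (hW : AEStronglyMeasurable W P) {p q : ℝ} (hp : 1 ≤ p) (hpq : p ≤ q) {C : ℝ} {n : ℕ}
    (h : ∀ w : Fin n → Ω, radNorm q (fun j => f (w j)) ≤ C * (∑ j, ‖W (w j)‖ ^ p) ^ (1 / p)) :
    eLpNorm (fun w : Fin n → Ω => ∑ j, (f (w j) - ∫ ω, f ω ∂P)) (ENNReal.ofReal q)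
        (Measure.pi fun _ => P) ≤
      2 * ENNReal.ofReal C * (n : ℝ≥0∞) ^ (1 / p) * eLpNorm W (ENNReal.ofReal q) P := by
  have hq : 1 ≤ q := hp.trans hpq
  calc _ ≤ 2 * eLpNorm (fun w : Fin n → Ω => radNorm q fun j => f (w j)) (ENNReal.ofReal q)
        (Measure.pi fun _ => P) := eLpNorm_sum_sub_integral_le_radNorm hf hq n
    _ ≤ 2 * (ENNReal.ofReal C * eLpNorm (fun w : Fin n → Ω => (∑ j, ‖W (w j)‖ ^ p) ^ (1 / p))
        (ENNReal.ofReal q) (Measure.pi fun _ => P)) := by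
        gcongr
        refine eLpNorm_le_mul_eLpNorm_of_ae_le_mul (.of_forall fun w => ?_) _
        rw [Real.norm_of_nonneg (radNorm_nonneg _ _), Real.norm_of_nonneg (by positivity)]
        exact h w
    _ ≤ 2 * (ENNReal.ofReal C * ((n : ℝ≥0∞) ^ (1 / p) * eLpNorm W (ENNReal.ofReal q) P)) := by
        gcongr
        exact eLpNorm_sum_rpow_pi_le hW (one_pos.trans_le hp) hpq n
    _ = _ := by simp only [mul_assoc]

end Symmetrization

section LrNorm

variable {Ω F : Type*} [MeasurableSpace Ω] {P : Measure Ω} [NormedAddCommGroup F]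

theorem lrNorm_nonneg (r : ℝ) (f : Ω → F) : 0 ≤ lrNorm r f P :=
  ENNReal.toReal_nonneg

theorem lrNorm_const_smul [NormedSpace ℝ F] (r c : ℝ) (f : Ω → F) :
    lrNorm r (fun ω => c • f ω) P = |c| * lrNorm r f P := by
  have h := eLpNorm_const_smul c f (ENNReal.ofReal r) P
  simpa [lrNorm, Pi.smul_def] using congrArg ENNReal.toReal h

theorem lrNorm_add_le {r : ℝ} (hr : 1 ≤ r) {f g : Ω → F} (hf : MemLp f (ENNReal.ofReal r) P)
    (hg : MemLp g (ENNReal.ofReal r) P) :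
    lrNorm r (fun ω => f ω + g ω) P ≤ lrNorm r f P + lrNorm r g P := by
  rw [lrNorm, lrNorm, lrNorm, ← ENNReal.toReal_add hf.eLpNorm_ne_top hg.eLpNorm_ne_top]
  exact ENNReal.toReal_mono (ENNReal.add_ne_top.2 ⟨hf.eLpNorm_ne_top, hg.eLpNorm_ne_top⟩)
    (eLpNorm_add_le hf.aestronglyMeasurable hg.aestronglyMeasurable (ENNReal.one_le_ofReal.2 hr))

theorem lrNorm_sum_le {ι : Type*} {r : ℝ} (hr : 1 ≤ r) (s : Finset ι) {f : ι → Ω → F}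
    (hf : ∀ i ∈ s, MemLp (f i) (ENNReal.ofReal r) P) :
    lrNorm r (fun ω => ∑ i ∈ s, f i ω) P ≤ ∑ i ∈ s, lrNorm r (f i) P := by
  have h := eLpNorm_sum_le (fun i hi => (hf i hi).aestronglyMeasurable)
    (ENNReal.one_le_ofReal.2 hr)
  have hfin : ∀ i ∈ s, eLpNorm (f i) (ENNReal.ofReal r) P ≠ ∞ := fun i hi =>
    (hf i hi).eLpNorm_ne_top
  rw [Finset.sum_fn] at h
  exact (ENNReal.toReal_mono (ENNReal.sum_ne_top.2 hfin) h).trans_eq (ENNReal.toReal_sum hfin)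

theorem lrNorm_const [IsProbabilityMeasure P] {r : ℝ} (hr : 0 < r) (c : F) :
    lrNorm r (fun _ => c) P = ‖c‖ := by
  rw [lrNorm, eLpNorm_const c (by simpa using hr) (NeZero.ne P)]
  simp

theorem lrNorm_const_sub_sum_le [IsProbabilityMeasure P] {ι : Type*} {r : ℝ} (hr : 1 ≤ r)
    (s : Finset ι) {f : ι → Ω → F} (hf : ∀ i ∈ s, MemLp (f i) (ENNReal.ofReal r) P) (m : ι → F)
    (U : F) :
    lrNorm r (fun ω => U - ∑ i ∈ s, f i ω) P ≤
      ‖U - ∑ i ∈ s, m i‖ + ∑ i ∈ s, lrNorm r (fun ω => m i - f i ω) P := by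
  have hdiff : ∀ i ∈ s, MemLp (fun ω => m i - f i ω) (ENNReal.ofReal r) P := fun i hi =>
    (memLp_const _).sub (hf i hi)
  calc lrNorm r (fun ω => U - ∑ i ∈ s, f i ω) P
      = lrNorm r (fun ω => (U - ∑ i ∈ s, m i) + ∑ i ∈ s, (m i - f i ω)) P := by
        simp only [Finset.sum_sub_distrib, sub_add_sub_cancel]
    _ ≤ lrNorm r (fun _ => U - ∑ i ∈ s, m i) P + lrNorm r (fun ω => ∑ i ∈ s, (m i - f i ω)) P :=
        lrNorm_add_le hr (memLp_const _) (memLp_finsetSum s hdiff)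
    _ ≤ _ := add_le_add (lrNorm_const (one_pos.trans_le hr) _).le (lrNorm_sum_le hr s hdiff)

theorem sum_Icc_integral_sub_pred [NormedSpace ℝ F] {f : ℕ → Ω → F} {L : ℕ}
    (hf : ∀ ℓ ≤ L, Integrable (f ℓ) P) :
    ∑ ℓ ∈ Finset.Icc 1 L, ∫ ω, (f ℓ ω - f (ℓ - 1) ω) ∂P = ∫ ω, f L ω ∂P - ∫ ω, f 0 ω ∂P := by
  induction L with
  | zero => simp
  | succ L ih =>
    rw [Finset.sum_Icc_succ_top (by omega), ih fun ℓ hℓ => hf ℓ (by omega), Nat.add_sub_cancel,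
      integral_sub (hf _ le_rfl) (hf _ (by omega))]
    abel

end LrNorm

section MonteCarlo

variable {Ω F : Type*} [MeasurableSpace Ω] {P : Measure Ω} [NormedAddCommGroup F]
  [MeasurableSpace F] [BorelSpace F]

theorem identDistrib_sum_sub_pi [IsProbabilityMeasure P] {n : ℕ} {ξ : Fin n → Ω → F} {ζ : Ω → F}
    (hζ : AEStronglyMeasurable ζ P) (hindep : iIndepFun ξ P)
    (hcopy : ∀ j, IdentDistrib (ξ j) ζ P P) (m : F) :
    IdentDistrib (fun ω => ∑ j, (ξ j ω - m)) (fun w : Fin n → Ω => ∑ j, (ζ (w j) - m)) P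
      (Measure.pi fun _ => P) := by
  have : IsProbabilityMeasure (P.map ζ) := Measure.isProbabilityMeasure_map hζ.aemeasurable
  have hjoint_law : P.map (fun ω j => ξ j ω) = Measure.pi fun _ => P.map ζ := by
    rw [(iIndepFun_iff_map_fun_eq_pi_map fun j => (hcopy j).aemeasurable_fst).1 hindep]
    simp only [(hcopy _).map_eq]
  have hjoint : IdentDistrib (fun ω j => ξ j ω) (fun (w : Fin n → Ω) j => ζ (w j)) P
      (Measure.pi fun _ => P) :=
    ⟨aemeasurable_pi_iff.2 fun j => (hcopy j).aemeasurable_fst,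
      aemeasurable_pi_iff.2 fun j => hζ.aemeasurable.comp_quasiMeasurePreserving
        (Measure.quasiMeasurePreserving_eval (μ := fun _ : Fin n => P) j),
      by rw [hjoint_law, Measure.pi_map_pi fun _ => hζ.aemeasurable]⟩
  have hid : AEStronglyMeasurable (id : F → F) (P.map ζ) :=
    IdentDistrib.aestronglyMeasurable_snd (f := ζ) (μ := P)
      ⟨hζ.aemeasurable, aemeasurable_id, by simp⟩ hζ
  have hsum : AEStronglyMeasurable (fun v : Fin n → F => ∑ j, (v j - m))
      (Measure.pi fun _ => P.map ζ) :=
    Finset.aestronglyMeasurable_fun_sum _ fun j _ =>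
      (hid.comp_quasiMeasurePreserving
        (Measure.quasiMeasurePreserving_eval (μ := fun _ : Fin n => P.map ζ) j)).sub
        aestronglyMeasurable_const
  exact hjoint.comp_of_aemeasurable (u := fun v : Fin n → F => ∑ j, (v j - m))
    (hjoint_law ▸ hsum.aemeasurable)

theorem memLp_const_smul_sum_of_identDistrib [NormedSpace ℝ F] {ι : Type*} [Fintype ι]
    {ξ : ι → Ω → F} {ζ : Ω → F} {r : ℝ≥0∞} (hζ : MemLp ζ r P)
    (hcopy : ∀ j, IdentDistrib (ξ j) ζ P P) (c : ℝ) : MemLp (fun ω => c • ∑ j, ξ j ω) r P :=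
  (memLp_finsetSum Finset.univ fun j _ => (hcopy j).symm.memLp_snd hζ).const_smul c

theorem lrNorm_integral_sub_average_le [IsProbabilityMeasure P] [NormedSpace ℝ F]
    [CompleteSpace F] {ζ : Ω → F} (hζ : Integrable ζ P) {p q : ℝ} (hp : 1 ≤ p) (hpq : p ≤ q)
    {W : Ω → ℝ} (hW : MemLp W (ENNReal.ofReal q) P) {C : ℝ} (hC : 0 ≤ C) {n : ℕ} (hn : n ≠ 0)
    (hrad : ∀ w : Fin n → Ω,
      radNorm q (fun j => ζ (w j)) ≤ C * (∑ j, ‖W (w j)‖ ^ p) ^ (1 / p))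
    {ξ : Fin n → Ω → F} (hindep : iIndepFun ξ P) (hcopy : ∀ j, IdentDistrib (ξ j) ζ P P) :
    lrNorm q (fun ω => ∫ ω', ζ ω' ∂P - (n : ℝ)⁻¹ • ∑ j, ξ j ω) P ≤
      2 * C * (n : ℝ) ^ (-(1 - 1 / p)) * lrNorm q W P := by
  set m := ∫ ω, ζ ω ∂P
  have hn0 : (n : ℝ) ≠ 0 := Nat.cast_ne_zero.2 hn
  have haverage : ∀ ω, m - (n : ℝ)⁻¹ • ∑ j, ξ j ω = (-(n : ℝ)⁻¹) • ∑ j, (ξ j ω - m) := fun ω => by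
    rw [Finset.sum_sub_distrib, Finset.sum_const, Finset.card_univ, Fintype.card_fin,
      ← Nat.cast_smul_eq_nsmul ℝ, neg_smul, smul_sub, inv_smul_smul₀ hn0, neg_sub]
  have hsum : lrNorm q (fun ω => ∑ j, (ξ j ω - m)) P ≤
      2 * C * (n : ℝ) ^ (1 / p) * lrNorm q W P := by
    have hpi := eLpNorm_sum_sub_integral_le_of_radNorm_le hζ hW.aestronglyMeasurable hp hpq hrad
    have hp0 : 0 ≤ 1 / p := one_div_nonneg.2 (zero_le_one.trans hp)
    rw [← (identDistrib_sum_sub_pi hζ.aestronglyMeasurable hindep hcopy m).eLpNorm_eq] at hpi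
    have hfin : 2 * ENNReal.ofReal C * (n : ℝ≥0∞) ^ (1 / p) * eLpNorm W (ENNReal.ofReal q) P ≠ ∞ :=
      ENNReal.mul_ne_top (ENNReal.mul_ne_top (ENNReal.mul_ne_top ENNReal.ofNat_ne_top
        ENNReal.ofReal_ne_top) (ENNReal.rpow_ne_top_of_nonneg hp0 (ENNReal.natCast_ne_top n)))
        hW.eLpNorm_ne_top
    simpa [lrNorm, hC, ← ENNReal.toReal_rpow] using ENNReal.toReal_mono hfin hpi
  simp only [haverage]
  rw [lrNorm_const_smul, abs_neg, abs_of_nonneg (by positivity)]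
  calc (n : ℝ)⁻¹ * lrNorm q (fun ω => ∑ j, (ξ j ω - m)) P
      ≤ (n : ℝ)⁻¹ * (2 * C * (n : ℝ) ^ (1 / p) * lrNorm q W P) := by gcongr
    _ = 2 * C * ((n : ℝ)⁻¹ * (n : ℝ) ^ (1 / p)) * lrNorm q W P := by ring
    _ = _ := by rw [neg_sub, Real.rpow_sub_one hn0, inv_mul_eq_div]

end MonteCarlo

section TensorMoments

variable {E : Type u} [NormedAddCommGroup E] {Ω : Type v} [MeasurableSpace Ω] {P : Measure Ω}

theorem eLpNorm_norm_pow_mul_norm_pow_le {X Y : Ω → E} (hX : AEStronglyMeasurable X P)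
    (hY : AEStronglyMeasurable Y P) {q : ℝ} (hq : 0 < q) {i l k : ℕ} (hk : k ≠ 0)
    (hil : i + l = k) :
    eLpNorm (fun ω => ‖X ω‖ ^ i * ‖Y ω‖ ^ l) (ENNReal.ofReal q) P ≤
      eLpNorm X (ENNReal.ofReal (k * q)) P ^ i * eLpNorm Y (ENNReal.ofReal (k * q)) P ^ l := by
  have hk0 : (0 : ℝ) < k := by positivity
  have hkq : 0 < k * q := by positivity
  have hexp : ∀ (a : ℝ≥0∞) (m : ℕ), (a ^ m) ^ q = (a ^ (k * q)) ^ ((m : ℝ) / k) := fun a m => by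
    rw [← ENNReal.rpow_natCast, ← ENNReal.rpow_mul, ← ENNReal.rpow_mul]
    congr 1
    field_simp
  have hconj : (i : ℝ) / k + l / k = 1 := by
    rw [← add_div, ← Nat.cast_add, hil, div_self hk0.ne']
  rw [← ENNReal.rpow_le_rpow_iff hq, eLpNorm_ofReal_rpow hq, ENNReal.mul_rpow_of_nonneg _ _ hq.le]
  simp only [enorm_mul, enorm_pow, enorm_norm, ENNReal.mul_rpow_of_nonneg _ _ hq.le, hexp,
    eLpNorm_ofReal_rpow hkq]
  exact ENNReal.lintegral_mul_norm_pow_le (hX.enorm.pow_const _) (hY.enorm.pow_const _)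
    (by positivity) (by positivity) hconj

theorem memLp_norm_pow_mul_norm_pow {X Y : Ω → E} {q : ℝ} (hq : 0 < q) {i l k : ℕ} (hk : k ≠ 0)
    (hil : i + l = k) (hX : MemLp X (ENNReal.ofReal (k * q)) P)
    (hY : MemLp Y (ENNReal.ofReal (k * q)) P) :
    MemLp (fun ω => ‖X ω‖ ^ i * ‖Y ω‖ ^ l) (ENNReal.ofReal q) P :=
  ⟨(hX.aestronglyMeasurable.norm.pow _).mul (hY.aestronglyMeasurable.norm.pow _),
    (eLpNorm_norm_pow_mul_norm_pow_le hX.aestronglyMeasurable hY.aestronglyMeasurable hq hk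
      hil).trans_lt (ENNReal.mul_lt_top (ENNReal.pow_lt_top hX.eLpNorm_lt_top)
        (ENNReal.pow_lt_top hY.eLpNorm_lt_top))⟩

theorem lrNorm_norm_pow_mul_norm_pow_le {X Y : Ω → E} {q : ℝ} (hq : 0 < q) {i l k : ℕ}
    (hk : k ≠ 0) (hil : i + l = k) (hX : MemLp X (ENNReal.ofReal (k * q)) P)
    (hY : MemLp Y (ENNReal.ofReal (k * q)) P) :
    lrNorm q (fun ω => ‖X ω‖ ^ i * ‖Y ω‖ ^ l) P ≤
      lrNorm (k * q) X P ^ i * lrNorm (k * q) Y P ^ l := by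
  simpa [lrNorm] using ENNReal.toReal_mono (ENNReal.mul_ne_top
    (ENNReal.pow_ne_top hX.eLpNorm_ne_top) (ENNReal.pow_ne_top hY.eLpNorm_ne_top))
    (eLpNorm_norm_pow_mul_norm_pow_le hX.aestronglyMeasurable hY.aestronglyMeasurable hq hk hil)

theorem memLp_tensorPow [NormedSpace ℝ E] {X : Ω → E} {q : ℝ} (hq : 0 < q) {k : ℕ} (hk : k ≠ 0)
    (hX : MemLp X (ENNReal.ofReal (k * q)) P) :
    MemLp (fun ω => tensorPow k (X ω)) (ENNReal.ofReal q) P := by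
  refine (memLp_norm_pow_mul_norm_pow hq hk (add_zero k) hX hX).of_le
    ((continuous_tensorPow k).comp_aestronglyMeasurable hX.aestronglyMeasurable)
    (.of_forall fun ω => ?_)
  simpa using norm_tensorPow_le hk (X ω)

theorem memLp_diffWeight {q : ℝ} (hq : 0 < q) {k : ℕ} {D Y : Ω → E}
    (hD : MemLp D (ENNReal.ofReal (k * q)) P) (hY : MemLp Y (ENNReal.ofReal (k * q)) P) :
    MemLp (fun ω => diffWeight k ‖D ω‖ ‖Y ω‖) (ENNReal.ofReal q) P := by
  simp only [diffWeight_eq_sum]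
  have hterm : ∀ i ∈ Finset.range k, MemLp (fun ω => (k.choose (i + 1) : ℝ) *
      (‖D ω‖ ^ (i + 1) * ‖Y ω‖ ^ (k - 1 - i))) (ENNReal.ofReal q) P := fun i hi => by
    have := Finset.mem_range.1 hi
    exact (memLp_norm_pow_mul_norm_pow hq (by omega) (by omega) hD hY).const_mul _
  exact (memLp_finsetSum _ hterm).const_mul (k : ℝ)

theorem lrNorm_diffWeight_le {q : ℝ} (hq : 1 ≤ q) {k : ℕ} {D Y : Ω → E}
    (hD : MemLp D (ENNReal.ofReal (k * q)) P) (hY : MemLp Y (ENNReal.ofReal (k * q)) P) :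
    lrNorm q (fun ω => diffWeight k ‖D ω‖ ‖Y ω‖) P ≤
      diffWeight k (lrNorm (k * q) D P) (lrNorm (k * q) Y P) := by
  have hq0 : 0 < q := one_pos.trans_le hq
  let g : ℕ → Ω → ℝ := fun i ω => ‖D ω‖ ^ (i + 1) * ‖Y ω‖ ^ (k - 1 - i)
  have hexp : ∀ i ∈ Finset.range k, k ≠ 0 ∧ i + 1 + (k - 1 - i) = k := fun i hi => by
    have := Finset.mem_range.1 hi
    omega
  have hmem : ∀ i ∈ Finset.range k,
      MemLp (fun ω => (k.choose (i + 1) : ℝ) • g i ω) (ENNReal.ofReal q) P := fun i hi =>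
    (memLp_norm_pow_mul_norm_pow hq0 (hexp i hi).1 (hexp i hi).2 hD hY).const_smul
      (k.choose (i + 1) : ℝ)
  calc lrNorm q (fun ω => diffWeight k ‖D ω‖ ‖Y ω‖) P
      = lrNorm q (fun ω => (k : ℝ) • ∑ i ∈ Finset.range k, (k.choose (i + 1) : ℝ) • g i ω) P := by
        simp only [diffWeight_eq_sum, smul_eq_mul, g]
    _ = k * lrNorm q (fun ω => ∑ i ∈ Finset.range k, (k.choose (i + 1) : ℝ) • g i ω) P := by
        rw [lrNorm_const_smul, Nat.abs_cast]
    _ ≤ k * ∑ i ∈ Finset.range k, lrNorm q (fun ω => (k.choose (i + 1) : ℝ) • g i ω) P := by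
        gcongr
        exact lrNorm_sum_le hq _ hmem
    _ ≤ k * ∑ i ∈ Finset.range k, k.choose (i + 1) *
          (lrNorm (k * q) D P ^ (i + 1) * lrNorm (k * q) Y P ^ (k - 1 - i)) := by
        gcongr with i hi
        rw [lrNorm_const_smul, Nat.abs_cast]
        gcongr
        exact lrNorm_norm_pow_mul_norm_pow_le hq0 (hexp i hi).1 (hexp i hi).2 hD hY
    _ = _ := (diffWeight_eq_sum k _ _).symm

variable [NormedSpace ℝ E]

theorem sum_integral_tensorPow_sub_eq_injMoment {k L : ℕ} (hk : k ≠ 0) {X : ℕ → Ω → E}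
    (hX0 : ∀ ω, X 0 ω = 0) (hX : ∀ ℓ ≤ L, Integrable (fun ω => tensorPow k (X ℓ ω)) P) :
    ∑ ℓ ∈ Finset.Icc 1 L, ∫ ω, (tensorPow k (X ℓ ω) - tensorPow k (X (ℓ - 1) ω)) ∂P =
      injMoment k (X L) P := by
  simp [sum_Icc_integral_sub_pred hX, hX0, tensorPow_zero hk, injMoment]

theorem mul_kahaneKhintchineConst_mul_typeConst_le_mlConst {p q : ℝ} (hE : HasRademacherType E p)
    (hq : 0 < q) (k : ℕ) :
    48 * kahaneKhintchineConst.{u} q 2 * typeConst E p * k ≤ mlConst E q p k := by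
  have hKp : 1 ≤ kahaneKhintchineConst.{u} q p := one_le_kahaneKhintchineConst hq hE.1.1
  have hK2 : 1 ≤ kahaneKhintchineConst.{u} q 2 := one_le_kahaneKhintchineConst hq one_le_two
  have hτ : 0 ≤ typeConst E p := typeConst_nonneg p
  have hpi : (3 / 2 : ℝ) ≤ √Real.pi := Real.le_sqrt_of_sq_le (by linarith [Real.pi_gt_three])
  have hfactor : (48 : ℝ) ≤ 32 * (√Real.pi * kahaneKhintchineConst.{u} q p) := by nlinarith
  calc 48 * kahaneKhintchineConst.{u} q 2 * typeConst E p * k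
      = 48 * (kahaneKhintchineConst.{u} q 2 * typeConst E p * k) := by ring
    _ ≤ 32 * (√Real.pi * kahaneKhintchineConst.{u} q p) *
        (kahaneKhintchineConst.{u} q 2 * typeConst E p * k) := by gcongr
    _ = 2 * diffConst E q p k := by rw [diffConst]; ring
    _ ≤ mlConst E q p k := mul_le_mul_of_nonneg_left (le_max_left _ _) zero_le_two

theorem mul_diffWeight_le_mlConst_mul {p q : ℝ} (hE : HasRademacherType E p) (hq : 0 < q) (k : ℕ)
    {d y : ℝ} (hd : 0 ≤ d) (hy : 0 ≤ y) {c : ℕ → ℝ} (hc : ∀ i, 0 ≤ c i) :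
    48 * kahaneKhintchineConst.{u} q 2 * typeConst E p * diffWeight k d y ≤
      mlConst E q p k *
        (d * ∑ i ∈ Finset.range k, ((k.choose (i + 1) : ℝ) * d ^ i + c i) * y ^ (k - i - 1)) := by
  have hterm : ∀ i ∈ Finset.range k, (k.choose (i + 1) : ℝ) * (d ^ (i + 1) * y ^ (k - 1 - i)) ≤
      d * (((k.choose (i + 1) : ℝ) * d ^ i + c i) * y ^ (k - i - 1)) := fun i _ => by
    rw [Nat.sub_right_comm]
    calc _ ≤ (k.choose (i + 1) : ℝ) * (d ^ (i + 1) * y ^ (k - i - 1)) +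
          d * (c i * y ^ (k - i - 1)) :=
          le_add_of_nonneg_right (mul_nonneg hd (mul_nonneg (hc i) (by positivity)))
      _ = _ := by ring
  have hK : 0 ≤ kahaneKhintchineConst.{u} q 2 :=
    zero_le_one.trans (one_le_kahaneKhintchineConst hq one_le_two)
  have hτ : 0 ≤ typeConst E p := typeConst_nonneg p
  have hconst := mul_kahaneKhintchineConst_mul_typeConst_le_mlConst hE hq k
  rw [diffWeight_eq_sum, ← mul_assoc, Finset.mul_sum _ _ d]
  exact mul_le_mul hconst (Finset.sum_le_sum hterm) (Finset.sum_nonneg fun i _ => by positivity)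
    ((by positivity : (0 : ℝ) ≤ _).trans hconst)

theorem lrNorm_integral_tensorPow_sub_average_le [IsProbabilityMeasure P] {p q : ℝ}
    (hE : HasRademacherType E p) (hpq : p ≤ q) {k : ℕ} (hk : k ≠ 0) {n : ℕ} (hn : n ≠ 0)
    {X Y : Ω → E} (hX : MemLp X (ENNReal.ofReal (k * q)) P)
    (hY : MemLp Y (ENNReal.ofReal (k * q)) P) {ξ : Fin n → Ω → SymInjTensor E k}
    (hindep : iIndepFun ξ P)
    (hcopy : ∀ j, IdentDistrib (ξ j) (fun ω => tensorPow k (X ω) - tensorPow k (Y ω)) P P) :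
    lrNorm q (fun ω => ∫ ω', (tensorPow k (X ω') - tensorPow k (Y ω')) ∂P -
        (n : ℝ)⁻¹ • ∑ j, ξ j ω) P ≤
      (n : ℝ) ^ (-(1 - 1 / p)) * (48 * kahaneKhintchineConst.{u} q 2 * typeConst E p *
        diffWeight k (lrNorm (k * q) (fun ω => X ω - Y ω) P) (lrNorm (k * q) Y P)) := by
  have hq1 : 1 ≤ q := hE.1.1.trans hpq
  have hq : 0 < q := one_pos.trans_le hq1
  have hK : 0 ≤ kahaneKhintchineConst.{u} q 2 :=
    zero_le_one.trans (one_le_kahaneKhintchineConst hq one_le_two)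
  have hτ : 0 ≤ typeConst E p := typeConst_nonneg p
  have hζ : Integrable (fun ω => tensorPow k (X ω) - tensorPow k (Y ω)) P :=
    ((memLp_tensorPow hq hk hX).sub (memLp_tensorPow hq hk hY)).integrable
      (ENNReal.one_le_ofReal.2 hq1)
  have hXY : MemLp (fun ω => X ω - Y ω) (ENNReal.ofReal (k * q)) P := hX.sub hY
  have hrad : ∀ w : Fin n → Ω,
      radNorm q (fun j => tensorPow k (X (w j)) - tensorPow k (Y (w j))) ≤
        24 * kahaneKhintchineConst.{u} q 2 * typeConst E p *
          (∑ j, ‖diffWeight k ‖X (w j) - Y (w j)‖ ‖Y (w j)‖‖ ^ p) ^ (1 / p) := fun w => by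
    simpa only [Real.norm_of_nonneg (diffWeight_nonneg k (norm_nonneg _) (norm_nonneg _))]
      using radNorm_tensorPow_sub_le_diffWeight hE hq hk _ _
  calc _ ≤ 2 * (24 * kahaneKhintchineConst.{u} q 2 * typeConst E p) * (n : ℝ) ^ (-(1 - 1 / p)) *
        lrNorm q (fun ω => diffWeight k ‖X ω - Y ω‖ ‖Y ω‖) P :=
        lrNorm_integral_sub_average_le hζ hE.1.1 hpq (memLp_diffWeight hq hXY hY) (by positivity)
          hn hrad hindep hcopy
    _ ≤ 2 * (24 * kahaneKhintchineConst.{u} q 2 * typeConst E p) * (n : ℝ) ^ (-(1 - 1 / p)) *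
        diffWeight k (lrNorm (k * q) (fun ω => X ω - Y ω) P) (lrNorm (k * q) Y P) := by
        gcongr
        exact lrNorm_diffWeight_le hq1 hXY hY
    _ = _ := by ring

theorem lrNorm_integral_tensorPow_sub_average_le_mlConst_mul [IsProbabilityMeasure P] {p q : ℝ}
    (hE : HasRademacherType E p) (hpq : p ≤ q) {k : ℕ} (hk : k ≠ 0) {n : ℕ} (hn : n ≠ 0)
    {X Y : Ω → E} (hX : MemLp X (ENNReal.ofReal (k * q)) P)
    (hY : MemLp Y (ENNReal.ofReal (k * q)) P) {ξ : Fin n → Ω → SymInjTensor E k}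
    (hindep : iIndepFun ξ P)
    (hcopy : ∀ j, IdentDistrib (ξ j) (fun ω => tensorPow k (X ω) - tensorPow k (Y ω)) P P)
    {c : ℕ → ℝ} (hc : ∀ i, 0 ≤ c i) :
    lrNorm q (fun ω => ∫ ω', (tensorPow k (X ω') - tensorPow k (Y ω')) ∂P -
        (n : ℝ)⁻¹ • ∑ j, ξ j ω) P ≤
      mlConst E q p k * ((n : ℝ) ^ (-(1 - 1 / p)) * lrNorm (k * q) (fun ω => X ω - Y ω) P *
        ∑ i ∈ Finset.range k,
          ((k.choose (i + 1) : ℝ) * lrNorm (k * q) (fun ω => X ω - Y ω) P ^ i + c i) *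
            lrNorm (k * q) Y P ^ (k - i - 1)) := by
  have hq : 0 < q := one_pos.trans_le (hE.1.1.trans hpq)
  rw [mul_assoc _ (lrNorm _ _ _), mul_left_comm]
  exact (lrNorm_integral_tensorPow_sub_average_le hE hpq hk hn hX hY hindep hcopy).trans
    (mul_le_mul_of_nonneg_left (mul_diffWeight_le_mlConst_mul hE hq k (lrNorm_nonneg _ _)
      (lrNorm_nonneg _ _) hc) (by positivity))

end TensorMoments

theorem mainTheorem2_general
    {E : Type u} [NormedAddCommGroup E] [NormedSpace ℝ E]
    {Ω : Type v} [MeasurableSpace Ω] (P : Measure Ω) [IsProbabilityMeasure P]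
    (p q : ℝ) (k L : ℕ) (hE : HasRademacherType E p) (hpq : p ≤ q) (hk : 1 ≤ k)
    (X : ℕ → Ω → E) (hX0 : ∀ ω, X 0 ω = 0)
    (hX : ∀ ℓ ∈ Finset.Icc 1 L, MemLp (X ℓ) (ENNReal.ofReal (k * q)) P)
    (M : ℕ → ℕ) (hM : ∀ ℓ ∈ Finset.Icc 1 L, 1 ≤ M ℓ)
    (ξ : (ℓ : ℕ) → Fin (M ℓ) → Ω → SymInjTensor E k)
    (hindep : ∀ ℓ ∈ Finset.Icc 1 L, iIndepFun (ξ ℓ) P)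
    (hcopy : ∀ ℓ ∈ Finset.Icc 1 L, ∀ j : Fin (M ℓ),
      IdentDistrib (ξ ℓ j)
        (fun ω => tensorPow k (X ℓ ω) - tensorPow k (X (ℓ - 1) ω)) P P) :
    (∀ ℓ ∈ Finset.Icc 1 L,
      MemLp (fun ω => tensorPow k (X ℓ ω) - tensorPow k (X (ℓ - 1) ω)) (ENNReal.ofReal q) P) ∧
    Integrable (fun ω => tensorPow k (X L ω)) P ∧
    ∀ U : SymInjTensor E k,
      MemLp (fun ω => U - ∑ ℓ ∈ Finset.Icc 1 L, (M ℓ : ℝ)⁻¹ • ∑ j : Fin (M ℓ), ξ ℓ j ω)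
        (ENNReal.ofReal q) P ∧
      lrNorm q (fun ω => U - ∑ ℓ ∈ Finset.Icc 1 L, (M ℓ : ℝ)⁻¹ • ∑ j : Fin (M ℓ), ξ ℓ j ω) P ≤
        ‖U - injMoment k (X L) P‖ +
        mlConst E q p k * ∑ ℓ ∈ Finset.Icc 1 L,
          ((M ℓ : ℝ) ^ (-(1 - 1 / p)) *
            lrNorm (k * q) (fun ω => X ℓ ω - X (ℓ - 1) ω) P *
            ∑ i ∈ Finset.range k,
              ((k.choose (i + 1) : ℝ) * lrNorm (k * q) (fun ω => X ℓ ω - X (ℓ - 1) ω) P ^ i +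
                  lrNorm k (X ℓ) P ^ i) *
                lrNorm (k * q) (X (ℓ - 1)) P ^ (k - i - 1)) := by
  have hk0 : k ≠ 0 := Nat.one_le_iff_ne_zero.1 hk
  have hq1 : 1 ≤ q := hE.1.1.trans hpq
  have hXmem : ∀ ℓ ≤ L, MemLp (X ℓ) (ENNReal.ofReal (k * q)) P := fun ℓ hℓL => by
    rcases ℓ.eq_zero_or_pos with rfl | hℓ
    · exact funext hX0 ▸ MemLp.zero
    · exact hX ℓ (Finset.mem_Icc.2 ⟨hℓ, hℓL⟩)
  have hT : ∀ ℓ ≤ L, MemLp (fun ω => tensorPow k (X ℓ ω)) (ENNReal.ofReal q) P := fun ℓ hℓL =>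
    memLp_tensorPow (one_pos.trans_le hq1) hk0 (hXmem ℓ hℓL)
  have hT_int : ∀ ℓ ≤ L, Integrable (fun ω => tensorPow k (X ℓ ω)) P := fun ℓ hℓL =>
    (hT ℓ hℓL).integrable (ENNReal.one_le_ofReal.2 hq1)
  have hle : ∀ ℓ ∈ Finset.Icc 1 L, ℓ ≤ L ∧ ℓ - 1 ≤ L := fun ℓ hℓ => by grind
  have hdiff : ∀ ℓ ∈ Finset.Icc 1 L, MemLp (fun ω => tensorPow k (X ℓ ω) -
      tensorPow k (X (ℓ - 1) ω)) (ENNReal.ofReal q) P := fun ℓ hℓ =>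
    (hT ℓ (hle ℓ hℓ).1).sub (hT _ (hle ℓ hℓ).2)
  have haverage := fun ℓ hℓ =>
    memLp_const_smul_sum_of_identDistrib (hdiff ℓ hℓ) (hcopy ℓ hℓ) (M ℓ : ℝ)⁻¹
  refine ⟨hdiff, hT_int L le_rfl, fun U => ⟨(memLp_const U).sub (memLp_finsetSum _ haverage), ?_⟩⟩
  rw [← sum_integral_tensorPow_sub_eq_injMoment hk0 hX0 hT_int, Finset.mul_sum]
  refine (lrNorm_const_sub_sum_le hq1 _ haverage _ U).trans
    (add_le_add_right (Finset.sum_le_sum fun ℓ hℓ => ?_) _)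
  exact lrNorm_integral_tensorPow_sub_average_le_mlConst_mul hE hpq hk0
    (Nat.one_le_iff_ne_zero.1 (hM ℓ hℓ)) (hXmem ℓ (hle ℓ hℓ).1) (hXmem _ (hle ℓ hℓ).2)
    (hindep ℓ hℓ) (hcopy ℓ hℓ) fun i => pow_nonneg (lrNorm_nonneg _ _) i

theorem mainTheorem2
    {E : Type u} [NormedAddCommGroup E] [NormedSpace ℝ E] [CompleteSpace E]
    {Ω : Type v} [MeasurableSpace Ω] (P : Measure Ω) [IsProbabilityMeasure P]
    (p q : ℝ) (k L : ℕ) (hE : HasRademacherType E p) (hpq : p ≤ q) (hk : 1 ≤ k) (hL : 1 ≤ L)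
    (X : ℕ → Ω → E) (hX0 : ∀ ω, X 0 ω = 0)
    (hX : ∀ ℓ ∈ Finset.Icc 1 L, MemLp (X ℓ) (ENNReal.ofReal (k * q)) P)
    (M : ℕ → ℕ) (hM : ∀ ℓ ∈ Finset.Icc 1 L, 1 ≤ M ℓ)
    (ξ : (ℓ : ℕ) → Fin (M ℓ) → Ω → SymInjTensor E k)
    (hindep : ∀ ℓ ∈ Finset.Icc 1 L, iIndepFun (ξ ℓ) P)
    (hcopy : ∀ ℓ ∈ Finset.Icc 1 L, ∀ j : Fin (M ℓ),
      IdentDistrib (ξ ℓ j)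
        (fun ω => tensorPow k (X ℓ ω) - tensorPow k (X (ℓ - 1) ω)) P P) :
    (∀ ℓ ∈ Finset.Icc 1 L,
      MemLp (fun ω => tensorPow k (X ℓ ω) - tensorPow k (X (ℓ - 1) ω)) (ENNReal.ofReal q) P) ∧
    Integrable (fun ω => tensorPow k (X L ω)) P ∧
    ∀ U : SymInjTensor E k,
      MemLp (fun ω => U - ∑ ℓ ∈ Finset.Icc 1 L, (M ℓ : ℝ)⁻¹ • ∑ j : Fin (M ℓ), ξ ℓ j ω)
        (ENNReal.ofReal q) P ∧
      lrNorm q (fun ω => U - ∑ ℓ ∈ Finset.Icc 1 L, (M ℓ : ℝ)⁻¹ • ∑ j : Fin (M ℓ), ξ ℓ j ω) P ≤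
        ‖U - injMoment k (X L) P‖ +
        mlConst E q p k * ∑ ℓ ∈ Finset.Icc 1 L,
          ((M ℓ : ℝ) ^ (-(1 - 1 / p)) *
            lrNorm (k * q) (fun ω => X ℓ ω - X (ℓ - 1) ω) P *
            ∑ i ∈ Finset.range k,
              ((k.choose (i + 1) : ℝ) * lrNorm (k * q) (fun ω => X ℓ ω - X (ℓ - 1) ω) P ^ i +
                  lrNorm k (X ℓ) P ^ i) *
                lrNorm (k * q) (X (ℓ - 1)) P ^ (k - i - 1)) :=
  mainTheorem2_general P p q k L hE hpq hk X hX0 hX M hM ξ hindep hcopy
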